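/- Let $n\ge 1$ client points $p_1,\dots,p_n\in\mathbb{R}^2$ and a speed $v>1$ be given. A freeway is a non-degenerate segment $h$ with endpoints $t,t'\in\mathbb{R}^2$, which may be entered and left at any of its points. The travel time from a client $p$ to a facility point $f\in\mathbb{R}^2$ is $$d_h(p,f)=\min\Bigl\{\|p-f\|_1,\ \min_{s,s'\in h}\bigl(\|p-s\|_1+\tfrac{\rho(s,s')}{v}+\|s'-f\|_1\bigr)\Bigr\},$$ where $\rho(s,s')=\|s-s'\|_1$ (the same result also holds with the Euclidean distance $\rho(s,s')=\|s-s'\|_2$ along the freeway). The 1-center 1-freeway (1C1F) problem asks for $f$ and $h$ minimizing $\max_{i}d_h(p_i,f)$. Suppose the orientation $\alpha$ of the highway is prescribed, i.e. only segments $h$ parallel to $(\cos\alpha,\sin\alpha)$ are allowed. Then both variants of the problem, namely 1. the fixed length variant, in which $h$ must in addition have a prescribed Euclidean length $\|t-t'\|_2=\ell>0$, and 2. the variable length variant, in which $h$ may have any positive length, can be solved in $O(n)$ time and $O(n)$ space. That is, for each variant there are a single program of a real RAM (unit cost operations $+,-,\times,\div$ and comparisons on real cells, with indirect addressing) and a constant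 $C$ such that, for every $n\ge 1$, all clients, all $v>1$, all $\alpha$ and (in the first variant) all $\ell>0$, on input $n$, $v$, $\cos\alpha$, $\sin\alpha$, $\ell$ (in the first variant) and the coordinates of the clients, the program halts after at most $Cn$ steps, uses at most $Cn$ memory cells, and outputs an optimal triple $(f,t,t')$. -/

import Mathlib

/-! ## A real random access machine

The memory consists of cells `mem 0, mem 1, …`, each holding one real number, and of integer
registers `idx 0, idx 1, …`. The only integer operations are loading a constant, copying,
successor and predecessor, so the integer registers serve as counters and cell addresses and
cannot be used to pack data. Each instruction costs one unit of time. -/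

namespace RealRAM

/-- A cell address: either a fixed cell, or the cell whose number is stored in an integer
register. -/
inductive Addr where
  | direct (k : ℕ)
  | indirect (r : ℕ)

/-- The arithmetic operations on real numbers. -/
inductive Op where
  | add
  | sub
  | mul
  | div

/-- The instructions; `target` is the number of the instruction to jump to. -/
inductive Instr where
  | const (d : Addr) (z : ℤ)
  | copy (d a : Addr)
  | arith (op : Op) (d a b : Addr)
  | jumpLe (a b : Addr) (target : ℕ)
  | idxConst (r k : ℕ)
  | idxCopy (r q : ℕ)
  | idxSucc (r : ℕ)
  | idxPred (r : ℕ)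
  | idxJumpLe (r q : ℕ) (target : ℕ)
  | halt

/-- A program is a finite list of instructions. -/
abbrev Program := List Instr

/-- A configuration: number of the current instruction, integer registers, real cells. -/
structure Config where
  pc : ℕ
  idx : ℕ → ℕ
  mem : ℕ → ℝ

/-- The number of the cell that an address refers to. -/
def Config.cell (c : Config) : Addr → ℕ
  | .direct k => k
  | .indirect r => c.idx r

/-- The content of the cell that an address refers to. -/
def Config.val (c : Config) (a : Addr) : ℝ := c.mem (c.cell a)

/-- Write `x` into the cell `d` and go to the next instruction. -/
def Config.write (c : Config) (d : Addr) (x : ℝ) : Config :=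
  ⟨c.pc + 1, c.idx, Function.update c.mem (c.cell d) x⟩

/-- Write `k` into the integer register `r` and go to the next instruction. -/
def Config.writeIdx (c : Config) (r k : ℕ) : Config :=
  ⟨c.pc + 1, Function.update c.idx r k, c.mem⟩

/-- The result of an arithmetic operation; division by zero is undefined. -/
noncomputable def Op.eval (x y : ℝ) : Op → Option ℝ
  | .add => some (x + y)
  | .sub => some (x - y)
  | .mul => some (x * y)
  | .div => if y = 0 then none else some (x / y)

/-- The effect of an instruction; `none` if there is no next configuration (the instruction is
`halt`, or the machine crashes on a division by zero). -/
noncomputable def Instr.exec (c : Config) : Instr → Option Config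
  | .const d z => some (c.write d z)
  | .copy d a => some (c.write d (c.val a))
  | .arith op d a b => (op.eval (c.val a) (c.val b)).map (c.write d)
  | .jumpLe a b target =>
      some ⟨if c.val a ≤ c.val b then target else c.pc + 1, c.idx, c.mem⟩
  | .idxConst r k => some (c.writeIdx r k)
  | .idxCopy r q => some (c.writeIdx r (c.idx q))
  | .idxSucc r => some (c.writeIdx r (c.idx r + 1))
  | .idxPred r => some (c.writeIdx r (c.idx r - 1))
  | .idxJumpLe r q target =>
      some ⟨if c.idx r ≤ c.idx q then target else c.pc + 1, c.idx, c.mem⟩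
  | .halt => none

/-- The real cells that an instruction reads or writes. -/
def Instr.accessed (c : Config) : Instr → List ℕ
  | .const d _ => [c.cell d]
  | .copy d a => [c.cell d, c.cell a]
  | .arith _ d a b => [c.cell d, c.cell a, c.cell b]
  | .jumpLe a b _ => [c.cell a, c.cell b]
  | _ => []

/-- `Runs P m c T c'`: started in `c`, the program `P` is in configuration `c'` after exactly `T`
steps, and these steps access only the first `m` real cells. (The number of integer registers
named in `P` is a constant.) -/
inductive Runs (P : Program) (m : ℕ) : Config → ℕ → Config → Prop where
  | refl (c : Config) : Runs P m c 0 c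
  | step {c c₁ c₂ : Config} {T : ℕ} {i : Instr} (hi : P[c.pc]? = some i)
      (hacc : ∀ a ∈ i.accessed c, a < m) (hexec : i.exec c = some c₁)
      (hrest : Runs P m c₁ T c₂) : Runs P m c (T + 1) c₂

/-- The initial configuration: `n` is stored in the integer register `0`, the input is stored in
the first real cells, and everything else is zero. -/
def initial (n : ℕ) (input : List ℝ) : Config :=
  ⟨0, Function.update 0 0 n, fun a => input.getD a 0⟩

/-- On the given input of size `n`, the program `P` halts after at most `time` steps, its whole
computation uses only the first `space` real cells, and the final contents of the cells
satisfies `Q`. -/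
def Computes (P : Program) (n : ℕ) (input : List ℝ) (time space : ℕ) (Q : (ℕ → ℝ) → Prop) :
    Prop :=
  ∃ T ≤ time, ∃ c : Config,
    Runs P space (initial n input) T c ∧ P[c.pc]? = some Instr.halt ∧ Q c.mem

end RealRAM

/-! ## Locating a facility point and a freeway -/

namespace FreewayLocation

/-- The `L₁` distance in the plane. -/
def l1Dist (p q : ℝ × ℝ) : ℝ := |p.1 - q.1| + |p.2 - q.2|

/-- The Euclidean distance in the plane. -/
noncomputable def l2Dist (p q : ℝ × ℝ) : ℝ := √((p.1 - q.1) ^ 2 + (p.2 - q.2) ^ 2)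

/-- The travel time from `p` to `f` in the presence of a freeway with endpoints `t`, `t'` and
speed `v`: either walk, or walk to a point `s` of the freeway, follow it to a point `s'`, and walk
from there. Distances along the freeway are measured by `ρ`. -/
noncomputable def travelTime (ρ : ℝ × ℝ → ℝ × ℝ → ℝ) (v : ℝ) (t t' p f : ℝ × ℝ) : ℝ :=
  min (l1Dist p f)
    (⨅ s : ↥(segment ℝ t t') × ↥(segment ℝ t t'),
      l1Dist p s.1 + ρ s.1 s.2 / v + l1Dist s.2 f)

/-- The largest travel time from a client to the facility `f`. -/
noncomputable def maxTravelTime (ρ : ℝ × ℝ → ℝ × ℝ → ℝ) (v : ℝ) {n : ℕ} (p : Fin n → ℝ × ℝ)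
    (f t t' : ℝ × ℝ) : ℝ :=
  ⨆ i, travelTime ρ v t t' (p i) f

/-- The segment with endpoints `t`, `t'` is non-degenerate and parallel to the direction
`(cos α, sin α)`. -/
def HasOrientation (α : ℝ) (t t' : ℝ × ℝ) : Prop :=
  ∃ r : ℝ, r ≠ 0 ∧ t' - t = r • (Real.cos α, Real.sin α)

/-- `(f, t, t')` minimizes the largest travel time among all facilities and all freeways whose
endpoints satisfy the constraint `feasible`. -/
def IsOptimal (ρ : ℝ × ℝ → ℝ × ℝ → ℝ) (v : ℝ) {n : ℕ} (p : Fin n → ℝ × ℝ)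
    (feasible : ℝ × ℝ → ℝ × ℝ → Prop) (f t t' : ℝ × ℝ) : Prop :=
  feasible t t' ∧
    ∀ g u u' : ℝ × ℝ, feasible u u' → maxTravelTime ρ v p f t t' ≤ maxTravelTime ρ v p g u u'

/-- The fixed length problem with given orientation `α`. -/
def SolvesFixedLength (ρ : ℝ × ℝ → ℝ × ℝ → ℝ) (v α ℓ : ℝ) {n : ℕ} (p : Fin n → ℝ × ℝ)
    (f t t' : ℝ × ℝ) : Prop :=
  IsOptimal ρ v p (fun u u' => HasOrientation α u u' ∧ l2Dist u u' = ℓ) f t t'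

/-- The variable length problem with given orientation `α`. -/
def SolvesVariableLength (ρ : ℝ × ℝ → ℝ × ℝ → ℝ) (v α : ℝ) {n : ℕ} (p : Fin n → ℝ × ℝ)
    (f t t' : ℝ × ℝ) : Prop :=
  IsOptimal ρ v p (HasOrientation α) f t t'

/-- The list `x₁, y₁, …, xₙ, yₙ` of the coordinates of the clients. -/
def coords {n : ℕ} (p : Fin n → ℝ × ℝ) : List ℝ :=
  (List.ofFn p).flatMap fun q => [q.1, q.2]

/-- The point stored in the cells `a`, `a + 1`. -/
def pointAt (mem : ℕ → ℝ) (a : ℕ) : ℝ × ℝ := (mem a, mem (a + 1))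

end FreewayLocation

namespace RealRAM

/-! ## Running programs -/

section Running

variable {P : Program} {m : ℕ}

/-! Geometry. A symmetry of the square, which preserves the L₁ norm, turns the freeway direction
into `(c, s)` with `0 ≤ s ≤ c`. Let `κ` be the time to ride along the direction vector. If the
facility lies on the freeway, the points reached in time `r` form a union of L₁ balls of radius `r -
κ|l|` centred at distance `l` along the freeway. This union is an octagon: its eight normals depend
only on direction and speed, and its offsets are affine in `r` and in the length `b` of freeway
ahead of the facility (`InOctagon.exists_entry`). A facility off the freeway gains nothing. The
points it reaches lie in the octagon of a freeway of the same length through it, with one `b` that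
serves all clients and all times (`exists_inOctagon`).

Hence, for given length, the task is to find the least `r` for which some translate of some octagon
contains all clients. This depends on the clients only through eight maxima of linear forms. Given
these, it is a linear program of constant size in the facility, `b` and `r`. Fourier–Motzkin
elimination writes an optimal solution as a fixed term in arithmetic operations and comparisons
(`exists_expressible_solution`).

If the length is free, let `R` be the largest L₁ norm of a client. Walking to the origin already
takes time at most `R`, so only freeways on which everybody travels in time at most `R` can do
better. They are ridden for at most `R / κ` in each direction, so length `2 (R + 1) / κ` suffices.
`R` is one more maximum.

Computation. Terms with case distinctions compile to straight code with forward jumps, of constant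
size (`Term.Eval.runs`). One pass over the clients updates the nine maxima, and the solution terms
are then evaluated once (`exists_program_of_expressible`). No square roots are needed: the direction
is a unit vector, so Euclidean length is just the parameter length. The two metrics differ only in
the factor `w`. -/

theorem Runs.trans {c c₁ c₂ : Config} {T₁ T₂ : ℕ} (h₁ : Runs P m c T₁ c₁)
    (h₂ : Runs P m c₁ T₂ c₂) : Runs P m c (T₁ + T₂) c₂ := by
  induction h₁ with
  | refl c => simpa using h₂
  | step hi hacc hexec _ ih =>
    rw [Nat.add_right_comm]
    exact .step hi hacc hexec (ih h₂)

theorem Runs.single {c c₁ : Config} {i : Instr} (hi : P[c.pc]? = some i)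
    (hacc : ∀ a ∈ i.accessed c, a < m) (hexec : i.exec c = some c₁) : Runs P m c 1 c₁ :=
  .step hi hacc hexec (.refl _)

/-- The code `l` is found in the program `P` from instruction number `a` on. -/
def CodeAt (P : Program) : ℕ → List Instr → Prop
  | _, [] => True
  | a, i :: l => P[a]? = some i ∧ CodeAt P (a + 1) l

theorem codeAt_append {a : ℕ} {l l' : List Instr} :
    CodeAt P a (l ++ l') ↔ CodeAt P a l ∧ CodeAt P (a + l.length) l' := by
  induction l generalizing a with
  | nil => simp [CodeAt]
  | cons i l ih => simp [CodeAt, ih, and_assoc, Nat.add_assoc, Nat.add_comm 1]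

theorem codeAt_self_append (l l' : List Instr) : CodeAt (l ++ l') l.length l' := by
  induction l' generalizing l with
  | nil => trivial
  | cons i l' ih =>
    refine ⟨by simp, ?_⟩
    simpa using ih (l ++ [i])

end Running

/-! ## Terms with case distinctions and their compilation -/

/-- Real terms with case distinctions, in variables from `ν`. -/
inductive Term (ν : Type) where
  | var (i : ν)
  | const (z : ℤ)
  | arith (op : Op) (a b : Term ν)
  | ite (a b s t : Term ν)

namespace Term

variable {ν : Type}

/-- The value of a term; `ite a b s t` is `s` if `a ≤ b`, and `t` otherwise. -/
inductive Eval (env : ν → ℝ) : Term ν → ℝ → Prop where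
  | var (i : ν) : Eval env (.var i) (env i)
  | const (z : ℤ) : Eval env (.const z) z
  | arith {op : Op} {a b : Term ν} {x y z : ℝ} : Eval env a x → Eval env b y →
      op.eval x y = some z → Eval env (.arith op a b) z
  | ite_le {a b s t : Term ν} {x y z : ℝ} : Eval env a x → Eval env b y → x ≤ y →
      Eval env s z → Eval env (.ite a b s t) z
  | ite_gt {a b s t : Term ν} {x y z : ℝ} : Eval env a x → Eval env b y → y < x →
      Eval env t z → Eval env (.ite a b s t) z

/-- The number of instructions that a term is compiled to. -/
def size : Term ν → ℕ
  | .var _ => 1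
  | .const _ => 1
  | .arith _ a b => a.size + b.size + 1
  | .ite a b s t => a.size + b.size + s.size + t.size + 2

theorem size_pos (e : Term ν) : 1 ≤ e.size := by
  cases e <;> simp [size]

end Term

/-- The working cell number `j`; its address is kept in the integer register `5 + j`. -/
def work (j : ℕ) : Addr := .indirect (5 + j)

/-- Code that starts at instruction `k` and computes the value of a term in the working cell `t`,
using only the working cells from `t` on as scratch. The variable `i` is stored in the working
cell `pos i`. -/
def Term.compile {ν : Type} (pos : ν → ℕ) : Term ν → ℕ → ℕ → List Instr
  | .var i, t, _ => [.copy (work t) (work (pos i))]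
  | .const z, t, _ => [.const (work t) z]
  | .arith op a b, t, k =>
      a.compile pos t k ++ (b.compile pos (t + 1) (k + a.size) ++
        [.arith op (work t) (work t) (work (t + 1))])
  | .ite a b s e, t, k =>
      a.compile pos t k ++ (b.compile pos (t + 1) (k + a.size) ++
        (.jumpLe (work t) (work (t + 1)) (k + a.size + b.size + 1 + e.size + 1) ::
        (e.compile pos t (k + a.size + b.size + 1) ++
        -- Comparing a cell with itself makes an unconditional jump, here over the code of the other
        -- branch.
        (.jumpLe (work t) (work t) (k + a.size + b.size + 1 + e.size + 1 + s.size) ::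
        s.compile pos t (k + a.size + b.size + 1 + e.size + 1)))))

@[simp]
theorem Term.length_compile {ν : Type} (pos : ν → ℕ) (e : Term ν) (t k : ℕ) :
    (e.compile pos t k).length = e.size := by
  induction e generalizing t k with
  | var i => rfl
  | const z => rfl
  | arith op a b iha ihb => simp [compile, size, iha, ihb, Nat.add_assoc]
  | ite a b s e iha ihb ihs ihe => simp [compile, size, iha, ihb, ihs, ihe]; omega

/-- The registers of the first `K` working cells are set up: the working cells are the cells
`base, …, base + K - 1`. -/
def Config.Ready (c : Config) (base K : ℕ) : Prop := ∀ j < K, c.idx (5 + j) = base + j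

theorem Config.Ready.cell_work {c : Config} {base K j : ℕ} (h : c.Ready base K) (hj : j < K) :
    c.cell (work j) = base + j := h j hj

/-- Cells below `t` stay untouched, so the first operand is safe in cell `t` while the second is
computed from `t + 1` on. Jumps only go forward, so each instruction runs at most once, and `size`
bounds code length, running time and scratch space alike. Only the branch taken has to have a value.
-/
theorem Term.Eval.runs {ν : Type} {pos : ν → ℕ} {P : Program} {space base K : ℕ}
    {env : ν → ℝ} (hK : base + K ≤ space) {e : Term ν} {x : ℝ} (he : e.Eval env x) :
    ∀ (t : ℕ) (c : Config), CodeAt P c.pc (e.compile pos t c.pc) → c.Ready base K →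
      t + e.size ≤ K → (∀ i, pos i < t) → (∀ i, c.mem (base + pos i) = env i) →
      ∃ T ≤ e.size, ∃ c' : Config, Runs P space c T c' ∧ c'.pc = c.pc + e.size ∧
        c'.idx = c.idx ∧ c'.mem (base + t) = x ∧ ∀ a < base + t, c'.mem a = c.mem a := by
  induction he with
  | var i =>
    intro t c hcode hc ht hpos henv
    simp only [compile, CodeAt, and_true, size] at hcode ht ⊢
    have h1 := hc.cell_work (j := t) (by omega)
    have h2 := hc.cell_work (j := pos i) (by have := hpos i; omega)
    refine ⟨1, le_rfl, _, Runs.single hcode ?_ rfl, rfl, rfl, ?_, ?_⟩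
    · have := hpos i
      simp only [Instr.accessed, h1, h2, List.mem_cons, List.not_mem_nil, or_false]
      rintro a (rfl | rfl) <;> omega
    · simp [Config.write, Config.val, h1, h2, henv]
    · intro a ha
      simp only [Config.write, h1]
      exact Function.update_of_ne (by omega) _ _
  | const z =>
    intro t c hcode hc ht hpos henv
    simp only [compile, CodeAt, and_true, size] at hcode ht ⊢
    have h1 := hc.cell_work (j := t) (by omega)
    refine ⟨1, le_rfl, _, Runs.single hcode ?_ rfl, rfl, rfl, ?_, ?_⟩
    · simp only [Instr.accessed, h1, List.mem_cons, List.not_mem_nil, or_false]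
      rintro a rfl; omega
    · simp [Config.write, h1]
    · intro a ha
      simp only [Config.write, h1]
      exact Function.update_of_ne (by omega) _ _
  | @arith op a b x y z ha hb hop iha ihb =>
    intro t c hcode hc ht hpos henv
    simp only [compile, codeAt_append, length_compile, CodeAt, and_true, size] at hcode ht ⊢
    have hbs := b.size_pos
    obtain ⟨T₁, hT₁, c₁, hr₁, hpc₁, hidx₁, hx₁, hm₁⟩ :=
      iha t c hcode.1 hc (by omega) hpos henv
    have hc₁ : c₁.Ready base K := by rw [Config.Ready, hidx₁]; exact hc
    obtain ⟨T₂, hT₂, c₂, hr₂, hpc₂, hidx₂, hx₂, hm₂⟩ :=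
      ihb (t + 1) c₁ (by rw [hpc₁]; exact hcode.2.1) hc₁ (by omega)
        (fun i => (hpos i).trans (Nat.lt_succ_self t))
        (fun i => by rw [hm₁ _ (by have := hpos i; omega), henv])
    have hc₂ : c₂.Ready base K := by rw [Config.Ready, hidx₂]; exact hc₁
    have h1 := hc₂.cell_work (j := t) (by omega)
    have h2 := hc₂.cell_work (j := t + 1) (by omega)
    have hv1 : c₂.val (work t) = x := by rw [Config.val, h1, hm₂ _ (by omega), hx₁]
    have hv2 : c₂.val (work (t + 1)) = y := by rw [Config.val, h2, hx₂]
    refine ⟨T₁ + T₂ + 1, by omega, _, (hr₁.trans hr₂).trans (Runs.single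
      (i := .arith op (work t) (work t) (work (t + 1))) (c₁ := c₂.write (work t) z) ?_ ?_ ?_),
      ?_, ?_, ?_, ?_⟩
    · rw [hpc₂, hpc₁]; exact hcode.2.2
    · simp only [Instr.accessed, h1, h2, List.mem_cons, List.not_mem_nil, or_false]
      rintro a (rfl | rfl | rfl) <;> omega
    · simp [Instr.exec, hv1, hv2, hop]
    · simp [Config.write, hpc₂, hpc₁]; omega
    · simp [Config.write, hidx₂, hidx₁]
    · simp [Config.write, h1]
    · intro a ha
      simp only [Config.write, h1]
      rw [Function.update_of_ne (by omega), hm₂ _ (by omega), hm₁ _ ha]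
  | @ite_le a b s e x y z ha hb hle hs iha ihb ihs =>
    intro t c hcode hc ht hpos henv
    simp only [compile, codeAt_append, length_compile, CodeAt, size] at hcode ht ⊢
    have hss := s.size_pos
    have hbs := b.size_pos
    obtain ⟨T₁, hT₁, c₁, hr₁, hpc₁, hidx₁, hx₁, hm₁⟩ :=
      iha t c hcode.1 hc (by omega) hpos henv
    have hc₁ : c₁.Ready base K := by rw [Config.Ready, hidx₁]; exact hc
    obtain ⟨T₂, hT₂, c₂, hr₂, hpc₂, hidx₂, hx₂, hm₂⟩ :=
      ihb (t + 1) c₁ (by rw [hpc₁]; exact hcode.2.1) hc₁ (by omega)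
        (fun i => (hpos i).trans (Nat.lt_succ_self t))
        (fun i => by rw [hm₁ _ (by have := hpos i; omega), henv])
    have hc₂ : c₂.Ready base K := by rw [Config.Ready, hidx₂]; exact hc₁
    have h1 := hc₂.cell_work (j := t) (by omega)
    have h2 := hc₂.cell_work (j := t + 1) (by omega)
    have hv1 : c₂.val (work t) = x := by rw [Config.val, h1, hm₂ _ (by omega), hx₁]
    have hv2 : c₂.val (work (t + 1)) = y := by rw [Config.val, h2, hx₂]
    set c₃ : Config := ⟨c.pc + a.size + b.size + 1 + e.size + 1, c₂.idx, c₂.mem⟩ with hc₃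
    have hr₃ : Runs P space c₂ 1 c₃ := by
      refine Runs.single (by rw [hpc₂, hpc₁]; exact hcode.2.2.1) ?_ ?_
      · simp only [Instr.accessed, h1, h2, List.mem_cons, List.not_mem_nil, or_false]
        rintro a (rfl | rfl) <;> omega
      · simp [Instr.exec, hv1, hv2, hle, hc₃]
    obtain ⟨T₄, hT₄, c₄, hr₄, hpc₄, hidx₄, hx₄, hm₄⟩ :=
      ihs t c₃ hcode.2.2.2.2.2 hc₂ (by omega) hpos
        (fun i => by
          have := hpos i
          change c₂.mem _ = _
          rw [hm₂ _ (by omega), hm₁ _ (by omega), henv])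
    refine ⟨T₁ + T₂ + 1 + T₄, by omega, c₄, ((hr₁.trans hr₂).trans hr₃).trans hr₄, ?_, ?_, hx₄, ?_⟩
    · rw [hpc₄]; simp only [hc₃]; omega
    · rw [hidx₄]; simp only [hc₃]; rw [hidx₂, hidx₁]
    · intro j hj
      rw [hm₄ _ hj, ← hm₁ _ hj, ← hm₂ _ (by omega)]
  | @ite_gt a b s e x y z ha hb hle hs iha ihb ihs =>
    intro t c hcode hc ht hpos henv
    simp only [compile, codeAt_append, length_compile, CodeAt, size] at hcode ht ⊢
    have hss := s.size_pos
    have hes := e.size_pos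
    have hbs := b.size_pos
    obtain ⟨T₁, hT₁, c₁, hr₁, hpc₁, hidx₁, hx₁, hm₁⟩ :=
      iha t c hcode.1 hc (by omega) hpos henv
    have hc₁ : c₁.Ready base K := by rw [Config.Ready, hidx₁]; exact hc
    obtain ⟨T₂, hT₂, c₂, hr₂, hpc₂, hidx₂, hx₂, hm₂⟩ :=
      ihb (t + 1) c₁ (by rw [hpc₁]; exact hcode.2.1) hc₁ (by omega)
        (fun i => (hpos i).trans (Nat.lt_succ_self t))
        (fun i => by rw [hm₁ _ (by have := hpos i; omega), henv])
    have hc₂ : c₂.Ready base K := by rw [Config.Ready, hidx₂]; exact hc₁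
    have h1 := hc₂.cell_work (j := t) (by omega)
    have h2 := hc₂.cell_work (j := t + 1) (by omega)
    have hv1 : c₂.val (work t) = x := by rw [Config.val, h1, hm₂ _ (by omega), hx₁]
    have hv2 : c₂.val (work (t + 1)) = y := by rw [Config.val, h2, hx₂]
    set c₃ : Config := ⟨c.pc + a.size + b.size + 1, c₂.idx, c₂.mem⟩ with hc₃
    have hr₃ : Runs P space c₂ 1 c₃ := by
      refine Runs.single (by rw [hpc₂, hpc₁]; exact hcode.2.2.1) ?_ ?_
      · simp only [Instr.accessed, h1, h2, List.mem_cons, List.not_mem_nil, or_false]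
        rintro a (rfl | rfl) <;> omega
      · simp [Instr.exec, hv1, hv2, hle, hc₃, hpc₂, hpc₁]
    obtain ⟨T₄, hT₄, c₄, hr₄, hpc₄, hidx₄, hx₄, hm₄⟩ :=
      ihs t c₃ hcode.2.2.2.1 hc₂ (by omega) hpos
        (fun i => by
          have := hpos i
          change c₂.mem _ = _
          rw [hm₂ _ (by omega), hm₁ _ (by omega), henv])
    have hc₄ : c₄.Ready base K := by rw [Config.Ready, hidx₄]; exact hc₂
    set c₅ : Config := ⟨c.pc + a.size + b.size + 1 + e.size + 1 + s.size, c₄.idx, c₄.mem⟩ with hc₅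
    have hr₅ : Runs P space c₄ 1 c₅ := by
      refine Runs.single (by rw [hpc₄]; exact hcode.2.2.2.2.1) ?_ ?_
      · simp only [Instr.accessed, hc₄.cell_work (j := t) (by omega), List.mem_cons,
          List.not_mem_nil, or_false]
        rintro a (rfl | rfl) <;> omega
      · simp [Instr.exec, hc₅]
    refine ⟨T₁ + T₂ + 1 + T₄ + 1, by omega, c₅, (((hr₁.trans hr₂).trans hr₃).trans hr₄).trans hr₅,
      ?_, ?_, hx₄, ?_⟩
    · simp only [hc₅]; omega
    · simp only [hc₅]; rw [hidx₄]; simp only [hc₃]; rw [hidx₂, hidx₁]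
    · intro j hj
      simp only [hc₅]
      rw [hm₄ _ hj, ← hm₁ _ hj, ← hm₂ _ (by omega)]

/-! ## Functions given by terms -/

/-- The function `f` is the value of a term in the variables `ν`. -/
def Expressible {ν : Type} (f : (ν → ℝ) → ℝ) : Prop :=
  ∃ e : Term ν, ∀ env, e.Eval env (f env)

namespace Expressible

variable {ν : Type} {f g h k : (ν → ℝ) → ℝ}

theorem var (i : ν) : Expressible (fun env : ν → ℝ => env i) := ⟨.var i, fun _ => .var i⟩

theorem const (z : ℤ) : Expressible (fun _ : ν → ℝ => (z : ℝ)) := ⟨.const z, fun _ => .const z⟩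

theorem zero : Expressible (fun _ : ν → ℝ => (0 : ℝ)) := by simpa using const (ν := ν) 0

theorem one : Expressible (fun _ : ν → ℝ => (1 : ℝ)) := by simpa using const (ν := ν) 1

theorem add (hf : Expressible f) (hg : Expressible g) : Expressible (fun env => f env + g env) :=
  let ⟨a, ha⟩ := hf
  let ⟨b, hb⟩ := hg
  ⟨.arith .add a b, fun env => .arith (ha env) (hb env) rfl⟩

theorem sub (hf : Expressible f) (hg : Expressible g) : Expressible (fun env => f env - g env) :=
  let ⟨a, ha⟩ := hf
  let ⟨b, hb⟩ := hg
  ⟨.arith .sub a b, fun env => .arith (ha env) (hb env) rfl⟩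

theorem mul (hf : Expressible f) (hg : Expressible g) : Expressible (fun env => f env * g env) :=
  let ⟨a, ha⟩ := hf
  let ⟨b, hb⟩ := hg
  ⟨.arith .mul a b, fun env => .arith (ha env) (hb env) rfl⟩

theorem ite (hf : Expressible f) (hg : Expressible g) (hh : Expressible h)
    (hk : Expressible k) : Expressible (fun env => if f env ≤ g env then h env else k env) := by
  obtain ⟨a, ha⟩ := hf
  obtain ⟨b, hb⟩ := hg
  obtain ⟨s, hs⟩ := hh
  obtain ⟨t, ht⟩ := hk
  refine ⟨.ite a b s t, fun env => ?_⟩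
  beta_reduce
  split_ifs with hle
  · exact .ite_le (ha env) (hb env) hle (hs env)
  · exact .ite_gt (ha env) (hb env) (not_le.1 hle) (ht env)

/-- The machine crashes on division by zero, whereas `x / 0 = 0` for real numbers here. The term
therefore first detects a zero denominator by two comparisons and then returns `0`. -/
theorem div (hf : Expressible f) (hg : Expressible g) : Expressible (fun env => f env / g env) := by
  obtain ⟨a, ha⟩ := hf
  obtain ⟨b, hb⟩ := hg
  refine ⟨.ite b (.const 0) (.ite (.const 0) b (.const 0) (.arith .div a b)) (.arith .div a b),
    fun env => ?_⟩
  have key (h0 : g env ≠ 0) : (Term.arith .div a b).Eval env (f env / g env) :=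
    .arith (ha env) (hb env) (by simp [Op.eval, h0])
  by_cases h1 : g env ≤ 0
  · refine .ite_le (hb env) (.const 0) (by simpa using h1) ?_
    by_cases h2 : 0 ≤ g env
    · refine .ite_le (.const 0) (hb env) (by simpa using h2) ?_
      beta_reduce
      rw [le_antisymm h1 h2, div_zero]
      simpa using Term.Eval.const (env := env) 0
    · exact .ite_gt (.const 0) (hb env) (by simpa using h2) (key fun h => h2 h.ge)
  · exact .ite_gt (hb env) (.const 0) (by simpa using h1) (key fun h => h1 h.le)

theorem neg (hf : Expressible f) : Expressible (fun env => -f env) := by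
  simpa using zero.sub hf

theorem max (hf : Expressible f) (hg : Expressible g) :
    Expressible (fun env => max (f env) (g env)) := by
  simpa only [max_def] using hf.ite hg hg hf

theorem min (hf : Expressible f) (hg : Expressible g) :
    Expressible (fun env => min (f env) (g env)) := by
  simpa only [min_def] using hf.ite hg hf hg

theorem abs (hf : Expressible f) : Expressible (fun env => |f env|) := by
  simpa only [abs_eq_max_neg] using hf.max hf.neg

theorem ite_lt (hf : Expressible f) (hg : Expressible g) (hh : Expressible h)
    (hk : Expressible k) : Expressible (fun env => if f env < g env then h env else k env) := by
  have := hg.ite hf hk hh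
  convert this using 2 with env
  by_cases hlt : f env < g env
  · rw [if_pos hlt, if_neg hlt.not_ge]
  · rw [if_neg hlt, if_pos (not_lt.1 hlt)]

theorem sum {ι : Type} (s : Finset ι) {F : ι → (ν → ℝ) → ℝ} (hF : ∀ i ∈ s, Expressible (F i)) :
    Expressible (fun env => ∑ i ∈ s, F i env) := by
  classical
  induction s using Finset.induction_on with
  | empty => simpa using zero
  | insert i s hi ih =>
    simp only [Finset.sum_insert hi]
    exact (hF i (by simp)).add (ih fun j hj => hF j (by simp [hj]))

end Expressible

end RealRAM

namespace RealRAM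

/-! ## Blocks of code -/

section Blocks

variable {P : Program} {space base K : ℕ}

/-- Code that copies the cells `g 0, …, g (m - 1)` to the cells `f 0, …, f (m - 1)`. -/
def copyBlock (f g : ℕ → Addr) (m : ℕ) : List Instr :=
  (List.range m).map fun i => .copy (f i) (g i)

@[simp]
theorem length_copyBlock (f g : ℕ → Addr) (m : ℕ) : (copyBlock f g m).length = m := by
  simp [copyBlock]

theorem copyBlock_succ (f g : ℕ → Addr) (m : ℕ) :
    copyBlock f g (m + 1) = copyBlock f g m ++ [.copy (f m) (g m)] := by
  simp [copyBlock, List.range_succ]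

/-- Copying leaves the integer registers alone, so it is enough to know the addresses for
configurations with the same registers. Disjointness keeps the source intact until it has been read.
-/
theorem runs_copyBlock {f g : ℕ → Addr} {m df sg : ℕ} {c : Config}
    (hcode : CodeAt P c.pc (copyBlock f g m))
    (hf : ∀ i < m, ∀ d : Config, d.idx = c.idx → d.cell (f i) = df + i)
    (hg : ∀ i < m, ∀ d : Config, d.idx = c.idx → d.cell (g i) = sg + i)
    (hdis : df + m ≤ sg ∨ sg + m ≤ df) (hdf : df + m ≤ space) (hsg : sg + m ≤ space) :
    ∃ c' : Config, Runs P space c m c' ∧ c'.pc = c.pc + m ∧ c'.idx = c.idx ∧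
      (∀ i < m, c'.mem (df + i) = c.mem (sg + i)) ∧
      ∀ a, (a < df ∨ df + m ≤ a) → c'.mem a = c.mem a := by
  induction m with
  | zero => exact ⟨c, .refl c, rfl, rfl, by simp, by simp⟩
  | succ m ih =>
    rw [copyBlock_succ, codeAt_append, length_copyBlock] at hcode
    obtain ⟨c₁, hr, hpc, hidx, hm, ho⟩ := ih hcode.1 (fun i hi => hf i (by omega))
      (fun i hi => hg i (by omega)) (by omega) (by omega) (by omega)
    have h1 := hf m (by omega) c₁ hidx
    have h2 := hg m (by omega) c₁ hidx
    refine ⟨c₁.write (f m) (c₁.val (g m)), hr.trans (Runs.single (i := .copy (f m) (g m))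
      (by rw [hpc]; exact hcode.2.1) ?_ rfl), by simp [Config.write, hpc, Nat.add_assoc],
      by simp [Config.write, hidx], ?_, ?_⟩
    · simp only [Instr.accessed, h1, h2, List.mem_cons, List.not_mem_nil, or_false]
      rintro a (rfl | rfl) <;> omega
    · intro i hi
      simp only [Config.write, h1, Config.val, h2]
      rcases Nat.lt_succ_iff_lt_or_eq.1 hi with hi | rfl
      · rw [Function.update_of_ne (by omega), hm i hi]
      · rw [Function.update_self, ho _ (by omega)]
    · intro a ha
      simp only [Config.write, h1]
      rw [Function.update_of_ne (by omega), ho a (by omega)]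

/-- The total size of a list of terms. -/
def totalSize {ν : Type} (es : List (Term ν)) : ℕ := (es.map Term.size).sum

/-- Code that evaluates the terms of a list into the working cells `t, t + 1, …`. -/
def evalAll {ν : Type} (pos : ν → ℕ) : List (Term ν) → ℕ → ℕ → List Instr
  | [], _, _ => []
  | e :: es, t, a => e.compile pos t a ++ evalAll pos es (t + 1) (a + e.size)

@[simp]
theorem length_evalAll {ν : Type} (pos : ν → ℕ) (es : List (Term ν)) (t a : ℕ) :
    (evalAll pos es t a).length = totalSize es := by
  induction es generalizing t a with
  | nil => rfl
  | cons e es ih => simp [evalAll, ih, totalSize]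

theorem length_le_totalSize {ν : Type} (es : List (Term ν)) : es.length ≤ totalSize es := by
  induction es with
  | nil => simp
  | cons e es ih =>
    have := e.size_pos
    simp only [List.length_cons, totalSize, List.map_cons, List.sum_cons] at ih ⊢
    omega

/-- All results go to cells from `t` on while the variables lie below `t`, so every term sees the
same, unmodified environment. -/
theorem runs_evalAll {ν : Type} {pos : ν → ℕ} {env : ν → ℝ} (hK : base + K ≤ space) :
    ∀ (es : List (Term ν)) (val : ℕ → ℝ) (t : ℕ) (c : Config),
      CodeAt P c.pc (evalAll pos es t c.pc) → c.Ready base K → t + totalSize es ≤ K →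
      (∀ i, pos i < t) → (∀ i, c.mem (base + pos i) = env i) →
      (∀ (j : ℕ) (h : j < es.length), es[j].Eval env (val j)) →
      ∃ T ≤ totalSize es, ∃ c' : Config, Runs P space c T c' ∧ c'.pc = c.pc + totalSize es ∧
        c'.idx = c.idx ∧ (∀ j < es.length, c'.mem (base + t + j) = val j) ∧
        ∀ a < base + t, c'.mem a = c.mem a
  | [], val, t, c, _, _, _, _, _, _ =>
    ⟨0, le_rfl, c, .refl c, rfl, rfl, by simp, by simp⟩
  | e :: es, val, t, c, hcode, hc, ht, hpos, henv, hval => by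
    simp only [evalAll, codeAt_append, Term.length_compile, totalSize, List.map_cons,
      List.sum_cons] at hcode ht ⊢
    have hes := e.size_pos
    obtain ⟨T₁, hT₁, c₁, hr₁, hpc₁, hidx₁, hx₁, hm₁⟩ :=
      (hval 0 (by simp)).runs hK t c hcode.1 hc (by simp; omega) hpos henv
    have hc₁ : c₁.Ready base K := by rw [Config.Ready, hidx₁]; exact hc
    simp only [List.getElem_cons_zero] at hT₁ hpc₁
    obtain ⟨T₂, hT₂, c₂, hr₂, hpc₂, hidx₂, hx₂, hm₂⟩ :=
      runs_evalAll hK es (fun j => val (j + 1)) (t + 1) c₁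
        (by rw [hpc₁]; exact hcode.2) hc₁ (by simp only [totalSize]; omega)
        (fun i => (hpos i).trans (Nat.lt_succ_self t))
        (fun i => by rw [hm₁ _ (by have := hpos i; omega), henv])
        (fun j h => hval (j + 1) (Nat.succ_lt_succ h))
    simp only [totalSize] at hT₂ hpc₂
    refine ⟨T₁ + T₂, by omega, c₂, hr₁.trans hr₂, by omega, by rw [hidx₂, hidx₁], ?_, ?_⟩
    · intro j hj
      rcases j with _ | j
      · rw [Nat.add_zero, hm₂ _ (by omega), hx₁]
      · rw [← hx₂ j (by simpa using hj)]; congr 1; omega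
    · intro a ha
      rw [hm₂ _ (by omega), hm₁ _ ha]

/-- Code that sets up the registers of the first `K` working cells, starting from the cell whose
number is in register `1`. -/
def setup : ℕ → List Instr
  | 0 => []
  | j + 1 => setup j ++ [.idxCopy (5 + j) 1, .idxSucc 1]

@[simp]
theorem length_setup (j : ℕ) : (setup j).length = 2 * j := by
  induction j with
  | zero => rfl
  | succ j ih => simp [setup, ih]; omega

/-- Direct addresses are constants of the program, but the working area begins behind an input whose
length depends on `n`. It can only be reached through registers filled at run time. -/
theorem runs_setup {c : Config} (hcode : CodeAt P c.pc (setup K)) :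
    ∃ c' : Config, Runs P space c (2 * K) c' ∧ c'.pc = c.pc + 2 * K ∧ c'.idx 0 = c.idx 0 ∧
      c'.idx 1 = c.idx 1 + K ∧ c'.mem = c.mem ∧ c'.Ready (c.idx 1) K := by
  induction K with
  | zero => exact ⟨c, .refl c, rfl, rfl, rfl, rfl, by simp [Config.Ready]⟩
  | succ K ih =>
    rw [setup, codeAt_append, length_setup] at hcode
    obtain ⟨c₁, hr, hpc, h0, h1, hm, hc⟩ := ih hcode.1
    rw [← hpc] at hcode
    refine ⟨(c₁.writeIdx (5 + K) (c₁.idx 1)).writeIdx 1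
        ((c₁.writeIdx (5 + K) (c₁.idx 1)).idx 1 + 1),
      hr.trans (.step hcode.2.1 (by simp [Instr.accessed]) rfl
        (.step hcode.2.2.1 (by simp [Instr.accessed]) rfl (.refl _))), ?_, ?_, ?_, ?_, ?_⟩
    · simp [Config.writeIdx, hpc]; omega
    · simp only [Config.writeIdx]
      rw [Function.update_of_ne (by omega), Function.update_of_ne (by omega), h0]
    · simp only [Config.writeIdx, Function.update_self]
      rw [Function.update_of_ne (by omega), h1]; omega
    · simp [Config.writeIdx, hm]
    · intro j hj
      simp only [Config.writeIdx]
      rw [Function.update_of_ne (by omega)]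
      rcases Nat.lt_succ_iff_lt_or_eq.1 hj with hj | rfl
      · rw [Function.update_of_ne (by omega), hc j hj]
      · rw [Function.update_self, h1]

/-- Code, to be placed at the start, that puts `k + 2 n` into register `1`, where `n` is the content of register `0`. -/
def findBase (k : ℕ) : List Instr :=
  [.idxConst 1 k, .idxConst 2 0, .idxJumpLe 0 2 7, .idxSucc 1, .idxSucc 1, .idxSucc 2,
    -- Always satisfied: an unconditional jump back to instruction 2, the loop test.
    .idxJumpLe 2 2 2]

theorem runs_findBase_loop {k : ℕ} :
    ∀ (_ : CodeAt P 0 (findBase k)) (r : ℕ) (c : Config), c.pc = 2 → c.idx 0 = c.idx 2 + r →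
      ∃ T ≤ 5 * r + 1, ∃ c' : Config, Runs P space c T c' ∧ c'.pc = 7 ∧ c'.idx 0 = c.idx 0 ∧
        c'.idx 1 = c.idx 1 + 2 * r ∧ c'.mem = c.mem
  | hcode, 0, c, hpc, hr => by
    refine ⟨1, le_rfl, ⟨7, c.idx, c.mem⟩, Runs.single (by rw [hpc]; exact hcode.2.2.1)
      (by simp [Instr.accessed]) ?_, rfl, rfl, rfl, rfl⟩
    simp [Instr.exec, hr]
  | hcode, r + 1, c, hpc, hr => by
    obtain ⟨-, -, h2, h3, h4, h5, h6, -⟩ := id hcode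
    set i₁ := Function.update c.idx 1 (c.idx 1 + 1) with hi₁
    set i₂ := Function.update i₁ 1 (i₁ 1 + 1) with hi₂
    set i₃ := Function.update i₂ 2 (i₂ 2 + 1) with hi₃
    have e0 : i₃ 0 = c.idx 0 := by simp [hi₃, hi₂, hi₁]
    have e1 : i₃ 1 = c.idx 1 + 2 := by simp [hi₃, hi₂, hi₁]
    have e2 : i₃ 2 = c.idx 2 + 1 := by simp [hi₃, hi₂, hi₁]
    obtain ⟨T, hT, c', hc', hpc', h0', h1', hm'⟩ :=
      runs_findBase_loop hcode r ⟨2, i₃, c.mem⟩ rfl (by simp only [e0, e2]; omega)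
    refine ⟨T + 1 + 1 + 1 + 1 + 1, by omega, c', ?_, hpc', by rw [h0']; exact e0,
      by rw [h1']; simp only [e1]; omega, hm'⟩
    refine .step (c₁ := ⟨3, c.idx, c.mem⟩) (by rw [hpc]; exact h2) (by simp [Instr.accessed])
      (by simp [Instr.exec, hpc]; omega) ?_
    refine .step (c₁ := ⟨4, i₁, c.mem⟩) h3 (by simp [Instr.accessed]) rfl ?_
    refine .step (c₁ := ⟨5, i₂, c.mem⟩) h4 (by simp [Instr.accessed]) rfl ?_
    refine .step (c₁ := ⟨6, i₃, c.mem⟩) h5 (by simp [Instr.accessed]) rfl ?_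
    exact .step h6 (by simp [Instr.accessed]) (by simp [Instr.exec]) hc'

theorem runs_findBase {k n : ℕ} (hcode : CodeAt P 0 (findBase k)) {c : Config} (hpc : c.pc = 0)
    (hn : c.idx 0 = n) :
    ∃ T ≤ 5 * n + 3, ∃ c' : Config, Runs P space c T c' ∧ c'.pc = 7 ∧ c'.idx 0 = n ∧
        c'.idx 1 = k + 2 * n ∧ c'.mem = c.mem := by
  set i₁ := Function.update c.idx 1 k with hi₁
  set i₂ := Function.update i₁ 2 0 with hi₂
  have e0 : i₂ 0 = n := by simp [hi₂, hi₁, hn]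
  have e1 : i₂ 1 = k := by simp [hi₂, hi₁]
  have e2 : i₂ 2 = 0 := by simp [hi₂]
  obtain ⟨T, hT, c', hc', hpc', h0', h1', hm'⟩ :=
    runs_findBase_loop hcode (space := space) n ⟨2, i₂, c.mem⟩ rfl
      (by simp only [e0, e2]; omega)
  refine ⟨T + 1 + 1, by omega, c', ?_, hpc', by rw [h0']; exact e0,
    by rw [h1']; simp only [e1], hm'⟩
  refine .step (c₁ := ⟨1, i₁, c.mem⟩) (by rw [hpc]; exact hcode.1) (by simp [Instr.accessed])
    (by simp [Instr.exec, Config.writeIdx, hpc, hi₁]) ?_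
  exact .step (c₁ := ⟨2, i₂, c.mem⟩) hcode.2.1 (by simp [Instr.accessed]) rfl hc'

end Blocks

/-! ## Programs that process the clients one after another -/

section Stream

variable {P : Program} {space base K k m : ℕ}

/-- The variables: the parameters, the coordinates of the current client, the maxima so far. -/
abbrev Vars (k m : ℕ) : Type := Fin k ⊕ Fin 2 ⊕ Fin m

/-- The working cell in which a variable is stored. -/
def slot (k m : ℕ) : Vars k m → ℕ :=
  Sum.elim (fun i => i) (Sum.elim (fun i => k + i) (fun i => k + 2 + i))

theorem slot_lt (i : Vars k m) : slot k m i < k + 2 + m := by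
  rcases i with i | i | i <;> simp [slot] <;> omega

/-- The values of the variables. -/
def envOf (par : Fin k → ℝ) (x y : ℝ) (acc : Fin m → ℝ) : Vars k m → ℝ :=
  Sum.elim par (Sum.elim ![x, y] acc)

/-- Code that loads the current client, evaluates terms, and stores their values as the new
maxima. -/
def round (k m : ℕ) (es : List (Term (Vars k m))) (a : ℕ) : List Instr :=
  copyBlock (fun i => work (k + i)) (fun i => .indirect (2 + i)) 2 ++
    (evalAll (slot k m) es (k + 2 + m) (a + 2) ++
      -- The new maxima replace the old ones only after all terms have been evaluated.
      copyBlock (fun j => work (k + 2 + j)) (fun j => work (k + 2 + m + j)) m)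

theorem length_round (es : List (Term (Vars k m))) (a : ℕ) :
    (round k m es a).length = 2 + (totalSize es + m) := by
  simp [round]

theorem runs_round {es : List (Term (Vars k m))} {c : Config} {q : ℕ} {par : Fin k → ℝ}
    {val : ℕ → ℝ} (hK : base + K ≤ space) (hcode : CodeAt P c.pc (round k m es c.pc))
    (hc : c.Ready base K) (hes : es.length = m) (hsize : k + 2 + m + totalSize es ≤ K)
    (h2 : c.idx 2 = q) (h3 : c.idx 3 = q + 1) (hq : q + 2 ≤ base)
    (hpar : ∀ i : Fin k, c.mem (base + i) = par i)
    (hval : ∀ (j : ℕ) (h : j < es.length), es[j].Eval (envOf par (c.mem q) (c.mem (q + 1))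
      (fun j => c.mem (base + (k + 2 + j)))) (val j)) :
    ∃ T ≤ 2 + (totalSize es + m), ∃ c' : Config, Runs P space c T c' ∧
      c'.pc = c.pc + (2 + (totalSize es + m)) ∧ c'.idx = c.idx ∧
      (∀ a < base + k, c'.mem a = c.mem a) ∧
      ∀ j < m, c'.mem (base + (k + 2 + j)) = val j := by
  have hml := length_le_totalSize es
  simp only [round, codeAt_append, length_copyBlock, length_evalAll] at hcode
  obtain ⟨c₁, hr₁, hpc₁, hidx₁, hx₁, hm₁⟩ := runs_copyBlock (space := space) (df := base + k)
    (sg := q) hcode.1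
    (fun i hi d hd => by
      have : d.Ready base K := by rw [Config.Ready, hd]; exact hc
      rw [this.cell_work (by omega), Nat.add_assoc])
    (fun i hi d hd => by
      change d.idx (2 + i) = _
      rw [hd]
      interval_cases i
      · exact h2
      · exact h3) (by omega) (by omega) (by omega)
  have hc₁ : c₁.Ready base K := by rw [Config.Ready, hidx₁]; exact hc
  obtain ⟨T₂, hT₂, c₂, hr₂, hpc₂, hidx₂, hx₂, hm₂⟩ := runs_evalAll hK es val (k + 2 + m) c₁
    (by rw [hpc₁]; exact hcode.2.1) hc₁ hsize slot_lt
    (by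
      rintro (i | i | i)
      · simp only [slot, envOf, Sum.elim_inl]
        rw [hm₁ _ (by omega), hpar]
      · have := hx₁ i i.2
        simp only [slot, envOf, Sum.elim_inl, Sum.elim_inr]
        rw [← Nat.add_assoc, this]
        fin_cases i <;> rfl
      · simp only [slot, envOf, Sum.elim_inr]
        rw [hm₁ _ (by omega)]) hval
  have hc₂ : c₂.Ready base K := by rw [Config.Ready, hidx₂]; exact hc₁
  obtain ⟨c₃, hr₃, hpc₃, hidx₃, hx₃, hm₃⟩ := runs_copyBlock (c := c₂) (space := space)
    (df := base + (k + 2)) (sg := base + (k + 2 + m)) (by rw [hpc₂, hpc₁]; exact hcode.2.2)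
    (fun i hi d hd => by
      have : d.Ready base K := by rw [Config.Ready, hd]; exact hc₂
      rw [this.cell_work (by omega), Nat.add_assoc base])
    (fun i hi d hd => by
      have : d.Ready base K := by rw [Config.Ready, hd]; exact hc₂
      rw [this.cell_work (by omega), Nat.add_assoc base]) (by omega) (by omega) (by omega)
  refine ⟨2 + T₂ + m, by omega, c₃, (hr₁.trans hr₂).trans hr₃, by omega,
    by rw [hidx₃, hidx₂, hidx₁], ?_, ?_⟩
  · intro a ha
    rw [hm₃ _ (by omega), hm₂ _ (by omega), hm₁ _ (by omega)]
  · intro j hj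
    rw [← Nat.add_assoc, hx₃ j hj, hx₂ j (by omega)]

/-- Code that does a round for each client; register `4` counts the clients. -/
def clientLoop (k m : ℕ) (es : List (Term (Vars k m))) (a : ℕ) : List Instr :=
  .idxJumpLe 0 4 (a + (2 + (totalSize es + m) + 7)) :: (round k m es (a + 1) ++
    [.idxSucc 2, .idxSucc 2, .idxSucc 3, .idxSucc 3, .idxSucc 4, .idxJumpLe 4 4 a])

theorem length_clientLoop (es : List (Term (Vars k m))) (a : ℕ) :
    (clientLoop k m es a).length = 2 + (totalSize es + m) + 7 := by
  simp [clientLoop, length_round]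

/-- Induction on the number `r` of clients left, with `t` clients done. The maxima are described by
their upper bounds `z`, which turns one update into `max_le_iff` and avoids naming a supremum over
an initial segment of the clients. -/
theorem runs_clientLoop {es : List (Term (Vars k m))} {a n : ℕ} {par : Fin k → ℝ}
    {g : Fin m → ℝ → ℝ → ℝ} {inp : ℕ → ℝ} (hK : base + K ≤ space)
    (hcode : CodeAt P a (clientLoop k m es a)) (hes : es.length = m)
    (hsize : k + 2 + m + totalSize es ≤ K) (hbase : k + 2 * n ≤ base)
    (hval : ∀ (x y : ℝ) (acc : Fin m → ℝ) (j : ℕ) (h : j < m),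
      (es[j]'(by omega)).Eval (envOf par x y acc) (max (g ⟨j, h⟩ x y) (acc ⟨j, h⟩))) :
    ∀ (r t : ℕ) (c : Config), t + r = n → c.pc = a → c.Ready base K → c.idx 0 = n →
      c.idx 4 = t → c.idx 2 = k + 2 * t → c.idx 3 = k + 2 * t + 1 →
      (∀ i : Fin k, c.mem (base + i) = par i) →
      (∀ i < base, c.mem i = inp i) →
      ∃ T ≤ r * (2 + (totalSize es + m) + 7) + 1, ∃ c' : Config, Runs P space c T c' ∧
        c'.pc = a + (2 + (totalSize es + m) + 7) ∧ c'.Ready base K ∧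
        (∀ i : Fin k, c'.mem (base + i) = par i) ∧
        ∀ (j : Fin m) (z : ℝ), c'.mem (base + (k + 2 + j)) ≤ z ↔
          c.mem (base + (k + 2 + j)) ≤ z ∧
            ∀ i, t ≤ i → i < n → g j (inp (k + 2 * i)) (inp (k + 2 * i + 1)) ≤ z
  | 0, t, c, hr, hpc, hc, h0, h4, _, _, hpar, _ => by
    refine ⟨1, by omega, ⟨a + (2 + (totalSize es + m) + 7), c.idx, c.mem⟩,
      Runs.single (by rw [hpc]; exact hcode.1) (by simp [Instr.accessed]) ?_, rfl, hc, hpar, ?_⟩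
    · simp only [Instr.exec]
      rw [if_pos (by omega)]
    · intro j z
      simp only [iff_self_and]
      intro _ i hi hi'
      omega
  | r + 1, t, c, hr, hpc, hc, h0, h4, h2, h3, hpar, hinp => by
    have hcode' := hcode
    simp only [clientLoop, CodeAt, codeAt_append, length_round] at hcode
    obtain ⟨hj, hround, i1, i2, i3, i4, i5, i6, -⟩ := hcode
    obtain ⟨T₁, hT₁, c₁, hr₁, hpc₁, hidx₁, hm₁, hx₁⟩ := runs_round (c := ⟨a + 1, c.idx, c.mem⟩)
      (val := fun j => if h : j < m then
        max (g ⟨j, h⟩ (c.mem (k + 2 * t)) (c.mem (k + 2 * t + 1)))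
          (c.mem (base + (k + 2 + j))) else 0)
      hK hround hc hes hsize h2 h3 (by omega) hpar
      (fun j h => by
        rw [hes] at h
        simpa only [h, dif_pos] using hval _ _ _ j h)
    simp only at hpc₁ hidx₁ hm₁ hx₁
    set j₁ := Function.update c.idx 2 (c.idx 2 + 1) with hj₁
    set j₂ := Function.update j₁ 2 (j₁ 2 + 1) with hj₂
    set j₃ := Function.update j₂ 3 (j₂ 3 + 1) with hj₃
    set j₄ := Function.update j₃ 3 (j₃ 3 + 1) with hj₄
    set j₅ := Function.update j₄ 4 (j₄ 4 + 1) with hj₅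
    have e0 : j₅ 0 = n := by simp [hj₅, hj₄, hj₃, hj₂, hj₁, h0]
    have e2 : j₅ 2 = k + 2 * (t + 1) := by simp [hj₅, hj₄, hj₃, hj₂, hj₁, h2]; omega
    have e3 : j₅ 3 = k + 2 * (t + 1) + 1 := by simp [hj₅, hj₄, hj₃, hj₂, hj₁, h3]; omega
    have e4 : j₅ 4 = t + 1 := by simp [hj₅, hj₄, hj₃, hj₂, hj₁, h4]
    have e5 : (Config.mk a j₅ c₁.mem).Ready base K := by
      intro j hj
      simp only [hj₅, hj₄, hj₃, hj₂, hj₁]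
      rw [Function.update_of_ne (by omega), Function.update_of_ne (by omega),
        Function.update_of_ne (by omega), Function.update_of_ne (by omega),
        Function.update_of_ne (by omega), hc j hj]
    obtain ⟨T, hT, c', hc', hpc', hready', hpar', hM'⟩ :=
      runs_clientLoop hK hcode' hes hsize hbase hval r (t + 1) ⟨a, j₅, c₁.mem⟩ (by omega) rfl e5
        e0 e4 e2 e3 (fun i => by rw [← hpar i]; exact hm₁ _ (by omega))
        (fun i hi => (hm₁ _ (by omega)).trans (hinp i hi))
    refine ⟨1 + (T₁ + (T + 1 + 1 + 1 + 1 + 1 + 1)), ?_, c', ?_, hpc', hready', hpar', ?_⟩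
    · rw [Nat.add_mul]; omega
    · refine (Runs.single (c₁ := ⟨a + 1, c.idx, c.mem⟩) (by rw [hpc]; exact hj)
        (by simp [Instr.accessed]) ?_).trans (hr₁.trans ?_)
      · simp only [Instr.exec]
        rw [if_neg (by omega), hpc]
      · have hc₁ : c₁ = ⟨a + 1 + (2 + (totalSize es + m)), c.idx, c₁.mem⟩ := by
          rw [← hidx₁, ← hpc₁]
        rw [hc₁]
        refine .step (c₁ := ⟨_, j₁, c₁.mem⟩) i1 (by simp [Instr.accessed]) rfl ?_
        refine .step (c₁ := ⟨_, j₂, c₁.mem⟩) i2 (by simp [Instr.accessed]) rfl ?_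
        refine .step (c₁ := ⟨_, j₃, c₁.mem⟩) i3 (by simp [Instr.accessed]) rfl ?_
        refine .step (c₁ := ⟨_, j₄, c₁.mem⟩) i4 (by simp [Instr.accessed]) rfl ?_
        refine .step (c₁ := ⟨_, j₅, c₁.mem⟩) i5 (by simp [Instr.accessed]) rfl ?_
        exact .step i6 (by simp [Instr.accessed]) (by simp [Instr.exec]) hc'
    · intro j z
      rw [hM', hx₁ j j.2, dif_pos j.2, max_le_iff, hinp _ (by omega), hinp _ (by omega)]
      constructor
      · rintro ⟨⟨h1, h2⟩, h3⟩
        refine ⟨h2, fun i hi hi' => ?_⟩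
        rcases hi.eq_or_lt with rfl | hi
        · exact h1
        · exact h3 i hi hi'
      · rintro ⟨h1, h2⟩
        exact ⟨⟨h2 t le_rfl (by omega), h1⟩, fun i hi hi' => h2 i (by omega) hi'⟩

end Stream

end RealRAM

/-! ### The cells in which the input list stores each client. -/

namespace FreewayLocation

theorem getD_coords {n : ℕ} (p : Fin n → ℝ × ℝ) (l : List ℝ) (i : Fin n) :
    (l ++ coords p).getD (l.length + 2 * i) 0 = (p i).1 ∧
      (l ++ coords p).getD (l.length + 2 * i + 1) 0 = (p i).2 := by
  have key : ∀ (l' : List (ℝ × ℝ)) (i : ℕ) (h : i < l'.length),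
      (l'.flatMap fun q => [q.1, q.2])[2 * i]? = some l'[i].1 ∧
        (l'.flatMap fun q => [q.1, q.2])[2 * i + 1]? = some l'[i].2 := by
    intro l'
    induction l' with
    | nil => simp
    | cons q l' ih =>
      rintro (_ | i) h
      · simp
      · simpa [Nat.mul_add] using ih i (by simpa using h)
  have := key (List.ofFn p) i (by simp)
  constructor
  · rw [List.getD_append_right _ _ _ _ (by omega), Nat.add_sub_cancel_left,
      List.getD_eq_getElem?_getD, coords, this.1]
    simp
  · rw [List.getD_append_right _ _ _ _ (by omega), Nat.add_assoc, Nat.add_sub_cancel_left,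
      List.getD_eq_getElem?_getD, coords, this.2]
    simp

end FreewayLocation

namespace RealRAM

open FreewayLocation in
/-- Any six functions of `k` parameters and of `m` maxima over the clients can be computed in
linear time and space, if everything is given by terms. -/
theorem exists_program_of_expressible {k m : ℕ} (g : Fin m → (Fin k → ℝ) → ℝ → ℝ → ℝ)
    (out : Fin 6 → (Vars k m → ℝ) → ℝ)
    (hg : ∀ j, Expressible fun env : Vars k m → ℝ =>
      g j (fun i => env (.inl i)) (env (.inr (.inl 0))) (env (.inr (.inl 1))))
    (hout : ∀ o, Expressible (out o)) :
    ∃ (P : Program) (C : ℕ), ∀ (n : ℕ) (p : Fin n → ℝ × ℝ) (par : Fin k → ℝ), 1 ≤ n →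
      Computes P n (List.ofFn par ++ coords p) (C * n) (C * n) fun mem =>
        ∃ env : Vars k m → ℝ, (∀ i, env (.inl i) = par i) ∧
          (∀ j z, env (.inr (.inr j)) ≤ z ↔ ∀ i, g j par (p i).1 (p i).2 ≤ z) ∧
          ∀ o : Fin 6, mem o = out o env := by
  choose tg htg using hg
  choose tout htout using hout
  have hmax (j : Fin m) : Expressible fun env : Vars k m → ℝ =>
      max (g j (fun i => env (.inl i)) (env (.inr (.inl 0))) (env (.inr (.inl 1))))
        (env (.inr (.inr j))) := .max ⟨tg j, htg j⟩ (.var (Sum.inr (Sum.inr j)))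
  choose tmax htmax using hmax
  set es₁ := List.ofFn tg with hes₁
  set es₂ := List.ofFn tmax with hes₂
  set es₃ := List.ofFn tout with hes₃
  have hl₁ : es₁.length = m := by simp [hes₁]
  have hl₂ : es₂.length = m := by simp [hes₂]
  have hl₃ : es₃.length = 6 := by simp [hes₃]
  have h6 := length_le_totalSize es₃
  set W := k + 2 + m with hW
  set K := W + (totalSize es₁ + totalSize es₂ + totalSize es₃) with hKdef
  set a₁ := 7 + 2 * K with ha₁
  set a₂ := a₁ + k with ha₂
  set a₃ := a₂ + 3 with ha₃
  set a₄ := a₃ + (2 + (totalSize es₁ + m)) with ha₄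
  set a₅ := a₄ + (2 + (totalSize es₂ + m) + 7) with ha₅
  -- The working area starts six cells behind the input, so that the six output cells never overlap
  -- the results they are copied from.
  set S₀ := findBase (k + 6) with hS₀
  set S₁ := setup K with hS₁
  set S₂ := copyBlock (fun i => work i) (fun i => .direct i) k with hS₂
  set S₃ : List Instr := [.idxConst 2 k, .idxConst 3 (k + 1), .idxConst 4 0] with hS₃
  -- No real number is neutral for `max`, so the maxima are initialized with the values of client
  -- `0`. The loop visits this client again, which is harmless. This is one use of `1 ≤ n`.
  set S₄ := round k m es₁ a₃ with hS₄
  set S₅ := clientLoop k m es₂ a₄ with hS₅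
  set S₆ := evalAll (slot k m) es₃ W a₅ with hS₆
  set S₇ := copyBlock (fun i => .direct i) (fun i => work (W + i)) 6 with hS₇
  set P : Program := S₀ ++ (S₁ ++ (S₂ ++ (S₃ ++ (S₄ ++ (S₅ ++ (S₆ ++ (S₇ ++ [.halt])))))))
    with hP
  have hcode : CodeAt P 0 P := codeAt_self_append [] P
  have hlen0 : S₀.length = 7 := rfl
  nth_rw 2 [hP] at hcode
  simp only [codeAt_append, hlen0, hS₁, hS₂, hS₃, hS₄, hS₅, hS₆, hS₇, length_setup,
    length_copyBlock, length_round, length_clientLoop, length_evalAll, List.length_cons,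
    List.length_nil, Nat.zero_add] at hcode
  obtain ⟨hc0, hc1, hc2, hc3, hc4, hc5, hc6, hc7, hc8⟩ := hcode
  set R := 2 + (totalSize es₂ + m) + 7 with hR
  -- The sum of the time and space bounds at `n = 1`; all constant terms are absorbed because `1 ≤
  -- n`.
  set C := 5 + 3 + 2 * K + k + 3 + (2 + (totalSize es₁ + m)) + R + 1 + totalSize es₃ + 6 +
    (k + 6 + 2 + K) with hC
  refine ⟨P, C, fun n p par hn => ?_⟩
  set inp : ℕ → ℝ := fun a => (List.ofFn par ++ coords p).getD a 0 with hinp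
  set base := k + 6 + 2 * n with hbase
  have hCn : 5 * n + n * R + (3 + 2 * K + k + 3 + (2 + (totalSize es₁ + m)) + 1 +
      totalSize es₃ + 6) + (k + 6 + 2 * n + K) ≤ C * n := by
    have h1 : (3 + 2 * K + k + 3 + (2 + (totalSize es₁ + m)) + 1 + totalSize es₃ + 6 +
      (k + 6 + K)) * 1 ≤ (3 + 2 * K + k + 3 + (2 + (totalSize es₁ + m)) + 1 + totalSize es₃ + 6 +
      (k + 6 + K)) * n := Nat.mul_le_mul_left _ hn
    have h2 : C * n = 5 * n + n * R + (3 + 2 * K + k + 3 + (2 + (totalSize es₁ + m)) + 1 +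
      totalSize es₃ + 6 + (k + 6 + K)) * n + 2 * n := by
      rw [hC]; ring
    omega
  have hspace : base + K ≤ C * n := by omega
  have hpar0 (i : Fin k) : inp i = par i := by
    have : (i : ℕ) < (List.ofFn par).length := by simp
    simp only [hinp]
    rw [List.getD_append _ _ _ _ this]
    simp
  have hx (i : Fin n) : inp (k + 2 * i) = (p i).1 ∧ inp (k + 2 * i + 1) = (p i).2 := by
    have := getD_coords p (List.ofFn par) i
    rwa [List.length_ofFn] at this
  obtain ⟨T₁, hT₁, c₁, hr₁, hpc₁, h01, h11, hm₁⟩ := runs_findBase (space := C * n) (n := n) hc0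
    (c := initial n (List.ofFn par ++ coords p)) rfl (by simp [initial])
  have hm₁ : c₁.mem = inp := hm₁
  obtain ⟨c₂, hr₂, hpc₂, h02, -, hm₂, hready₂⟩ := runs_setup (space := C * n) (c := c₁) (K := K)
    (by rw [hpc₁]; exact hc1)
  rw [h11] at hready₂
  obtain ⟨c₃, hr₃, hpc₃, hidx₃, hx₃, hm₃⟩ := runs_copyBlock (c := c₂) (df := base) (sg := 0)
    (m := k) (space := C * n) (by rw [hpc₂, hpc₁]; exact hc2)
    (fun i hi d hd => by
      have : d.Ready base K := by rw [Config.Ready, hd]; exact hready₂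
      rw [this.cell_work (by omega)])
    (fun i hi d hd => by simp [Config.cell]) (by omega) (by omega) (by omega)
  have hpc₃ : c₃.pc = a₂ := by omega
  set j₁ := Function.update c₃.idx 2 k with hj₁
  set j₂ := Function.update j₁ 3 (k + 1) with hj₂
  set j₃ := Function.update j₂ 4 0 with hj₃
  have hc₃ : c₃ = ⟨a₂, c₃.idx, c₃.mem⟩ := by rw [← hpc₃]
  have hr₄ : Runs P (C * n) c₃ 3 ⟨a₃, j₃, c₃.mem⟩ := by
    obtain ⟨i1, i2, i3, -⟩ := hc3
    rw [hc₃]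
    refine .step (c₁ := ⟨_, j₁, c₃.mem⟩) i1 (by simp [Instr.accessed]) rfl ?_
    refine .step (c₁ := ⟨_, j₂, c₃.mem⟩) i2 (by simp [Instr.accessed]) rfl ?_
    exact .step (c₁ := ⟨_, j₃, c₃.mem⟩) i3 (by simp [Instr.accessed]) rfl (.refl _)
  have e0 : j₃ 0 = n := by simp [hj₃, hj₂, hj₁, hidx₃, h02, h01]
  have e2 : j₃ 2 = k := by simp [hj₃, hj₂, hj₁]
  have e3 : j₃ 3 = k + 1 := by simp [hj₃, hj₂]
  have e4 : j₃ 4 = 0 := by simp [hj₃]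
  have e5 : ∀ j < K, j₃ (5 + j) = base + j := by
    intro j hj
    simp only [hj₃, hj₂, hj₁]
    rw [Function.update_of_ne (by omega), Function.update_of_ne (by omega),
      Function.update_of_ne (by omega), hidx₃, hready₂ j hj]
  have hpar3 (i : Fin k) : c₃.mem (base + i) = par i := by
    rw [hx₃ i i.2, hm₂, hm₁, Nat.zero_add, hpar0]
  have hinp3 (a : ℕ) (ha : a < base) : c₃.mem a = inp a := by
    rw [hm₃ _ (by omega), hm₂, hm₁]
  obtain ⟨T₅, hT₅, c₅, hr₅, hpc₅, hidx₅, hm₅, hx₅⟩ := runs_round (c := ⟨a₃, j₃, c₃.mem⟩)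
    (val := fun j => if h : j < m then g ⟨j, h⟩ par (p ⟨0, hn⟩).1 (p ⟨0, hn⟩).2 else 0)
    hspace hc4 e5 hl₁ (by omega) e2 e3 (by omega) hpar3
    (fun j h => by
      have hj : j < m := by omega
      have h1 := (hx ⟨0, hn⟩).1
      have h2 := (hx ⟨0, hn⟩).2
      simp only [Nat.mul_zero, Nat.add_zero] at h1 h2
      simp only [hes₁, List.getElem_ofFn, hj, dif_pos]
      rw [hinp3 k (by omega), hinp3 (k + 1) (by omega), h1, h2]
      exact htg ⟨j, hj⟩ (envOf par _ _ _))
  simp only at hpc₅ hidx₅ hm₅ hx₅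
  obtain ⟨T₆, hT₆, c₆, hr₆, hpc₆, hready₆, hpar₆, hM⟩ := runs_clientLoop (n := n) (par := par)
    (g := fun j => g j par) (inp := inp) hspace hc5 hl₂ (by omega) (by omega)
    (fun x y acc j h => by
      simp only [hes₂, List.getElem_ofFn]
      exact htmax ⟨j, h⟩ (envOf par x y acc))
    n 0 c₅ (by omega) hpc₅ (by rw [Config.Ready, hidx₅]; exact e5) (by rw [hidx₅, e0])
    (by rw [hidx₅, e4]) (by rw [hidx₅, e2]; rfl) (by rw [hidx₅, e3])
    (fun i => by rw [hm₅ _ (by omega), hpar3]) (fun i hi => by rw [hm₅ _ (by omega), hinp3 i hi])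
  set M : Fin m → ℝ := fun j => c₆.mem (base + (k + 2 + j)) with hMdef
  -- The two client variables still hold leftovers of the loop; the claim says nothing about them.
  set env := envOf par (c₆.mem (base + k)) (c₆.mem (base + (k + 1))) M with henv
  obtain ⟨T₇, hT₇, c₇, hr₇, hpc₇, hidx₇, hx₇, hm₇⟩ := runs_evalAll hspace es₃
    (env := env)
    (fun j => if h : j < 6 then out ⟨j, h⟩ env else 0) W c₆
    (by rw [hpc₆]; exact hc6) hready₆ (by omega) slot_lt
    (by
      rintro (i | i | i)
      · simp only [henv, slot, envOf, Sum.elim_inl]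
        rw [hpar₆]
      · simp only [henv, slot, envOf, Sum.elim_inl, Sum.elim_inr]
        fin_cases i <;> rfl
      · simp [henv, slot, envOf, hMdef])
    (fun j h => by
      have hj : j < 6 := by omega
      simp only [hes₃, List.getElem_ofFn, hj, dif_pos]
      exact htout ⟨j, hj⟩ env)
  obtain ⟨c₈, hr₈, hpc₈, hidx₈, hx₈, hm₈⟩ := runs_copyBlock (c := c₇) (df := 0) (sg := base + W)
    (m := 6) (space := C * n) (by rw [hpc₇, hpc₆]; exact hc7)
    (fun i hi d hd => by simp [Config.cell])
    (fun i hi d hd => by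
      have : d.Ready base K := by rw [Config.Ready, hd, hidx₇]; exact hready₆
      rw [this.cell_work (by omega)]; omega) (by omega) (by omega) (by omega)
  rw [← hR] at hT₆
  refine ⟨T₁ + 2 * K + k + 3 + T₅ + T₆ + T₇ + 6, by omega, c₈,
    (((((((hr₁.trans hr₂).trans hr₃).trans hr₄).trans hr₅).trans hr₆).trans hr₇).trans hr₈), ?_,
    env, fun i => rfl, ?_, ?_⟩
  · rw [hpc₈, hpc₇, hpc₆]; exact hc8.1
  · intro j z
    change M j ≤ z ↔ _
    rw [hM j z, hx₅ j j.2, dif_pos j.2]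
    constructor
    · rintro ⟨-, h⟩ i
      have := h i (Nat.zero_le _) i.2
      rwa [(hx i).1, (hx i).2] at this
    · intro h
      refine ⟨h _, fun i _ hi => ?_⟩
      rw [(hx ⟨i, hi⟩).1, (hx ⟨i, hi⟩).2]
      exact h _
  · intro o
    have := hx₈ o o.2
    rw [Nat.zero_add] at this
    rw [this, hx₇ o (by omega), dif_pos o.2]

end RealRAM

namespace RealRAM

/-! ## Linear programs of constant size -/

section LinearProgram

variable {ν : Type}

/-- Including `0` in the maximum serves two purposes: the empty family needs no special case, and
the sign condition on an unknown is built in. -/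
theorem Expressible.exists_sup {ι : Type} (s : Finset ι) {F : ι → (ν → ℝ) → ℝ}
    (hF : ∀ i, Expressible (F i)) :
    ∃ g : (ν → ℝ) → ℝ, Expressible g ∧
      ∀ env z, g env ≤ z ↔ 0 ≤ z ∧ ∀ i ∈ s, F i env ≤ z := by
  classical
  induction s using Finset.induction_on with
  | empty => exact ⟨fun _ => 0, .zero, by simp⟩
  | insert i s hi ih =>
    obtain ⟨g, hg, h⟩ := ih
    refine ⟨fun env => Max.max (F i env) (g env), (hF i).max hg, fun env z => ?_⟩
    rw [max_le_iff, h, Finset.forall_mem_insert]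
    tauto

/-- Back substitution in Fourier–Motzkin elimination. Rows with negative `a i` are lower bounds, and
`x` is the least nonnegative number above all of them. `h₁` says that every upper bound dominates
every lower bound, `h₂` that every upper bound is nonnegative and that the rows free of the unknown
hold. -/
theorem le_of_eliminated {ι : Type} {a b : ι → ℝ} {x : ℝ}
    (hx : ∀ z, x ≤ z ↔ 0 ≤ z ∧ ∀ i, (if a i < 0 then b i / a i else 0) ≤ z)
    (h₁ : ∀ i k, 0 < a i → a k < 0 → a k * b i ≤ a i * b k)
    (h₂ : ∀ i, 0 ≤ a i → 0 ≤ b i) (i : ι) : a i * x ≤ b i := by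
  rcases lt_trichotomy (a i) 0 with hi | hi | hi
  · have := ((hx x).1 le_rfl).2 i
    rw [if_pos hi, div_le_iff_of_neg hi] at this
    linarith
  · rw [hi, zero_mul]; exact h₂ i hi.ge
  · have : x ≤ b i / a i := by
      refine (hx _).2 ⟨div_nonneg (h₂ i hi.le) hi.le, fun k => ?_⟩
      split_ifs with hk
      · rw [div_le_iff_of_neg hk, div_mul_eq_mul_div, div_le_iff₀ hi]
        linarith [h₁ i k hi hk]
      · exact div_nonneg (h₂ i hi.le) hi.le
    rw [le_div_iff₀ hi] at this
    linarith

/-- A linear program of constant size in nonnegative unknowns, whose coefficients are given by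
terms, has an optimal solution that is given by terms. The last unknown is minimized. -/
theorem exists_expressible_solution (d : ℕ) : ∀ {ι : Type} [Fintype ι]
    (A : ι → Fin (d + 1) → (ν → ℝ) → ℝ) (B : ι → (ν → ℝ) → ℝ),
    (∀ i j, Expressible (A i j)) → (∀ i, Expressible (B i)) →
    ∃ x : Fin (d + 1) → (ν → ℝ) → ℝ, (∀ j, Expressible (x j)) ∧
      ∀ env (y : Fin (d + 1) → ℝ), (∀ j, 0 ≤ y j) →
        (∀ i, ∑ j, A i j env * y j ≤ B i env) →
        (∀ j, 0 ≤ x j env) ∧ (∀ i, ∑ j, A i j env * x j env ≤ B i env) ∧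
          x (Fin.last d) env ≤ y (Fin.last d) := by
  induction d with
  | zero =>
    intro ι _ A B hA hB
    obtain ⟨x, hx, h⟩ := Expressible.exists_sup Finset.univ
      (F := fun i env => if A i 0 env < 0 then B i env / A i 0 env else 0)
      (fun i => (hA i 0).ite_lt .zero ((hB i).div (hA i 0)) .zero)
    refine ⟨fun _ => x, fun _ => hx, fun env y hy hfeas => ?_⟩
    simp only [Finset.mem_univ, true_imp_iff] at h
    simp only [Nat.reduceAdd, Finset.univ_unique, Fin.default_eq_zero, Finset.sum_singleton,
      Fin.isValue] at hfeas ⊢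
    refine ⟨fun _ => ((h env _).1 le_rfl).1, ?_, (h env _).2 ⟨hy _, fun i => ?_⟩⟩
    · refine le_of_eliminated (h env) (fun i k hi hk => ?_) fun i hi => ?_
      · nlinarith [hfeas i, hfeas k]
      · exact (mul_nonneg hi (hy 0)).trans (hfeas i)
    · split_ifs with hi
      · rw [div_le_iff_of_neg hi]
        have := hfeas i
        rw [mul_comm] at this
        exact this
      · exact hy _
  | succ d ih =>
    intro ι _ A B hA hB
    -- Eliminate unknown `0`: each upper-bound row is paired with each lower-bound row, and the rows
    -- with nonnegative coefficient are kept, since the unknown is nonnegative. The signs depend on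
    -- `env` but the index type must not, so index combinations that do not apply become the row `0
    -- ≤ 0`.
    let comb (F : ι → (ν → ℝ) → ℝ) : (ι × ι) ⊕ ι → (ν → ℝ) → ℝ :=
      Sum.elim (fun q env => if 0 < A q.1 0 env then
          (if A q.2 0 env < 0 then A q.1 0 env * F q.2 env - A q.2 0 env * F q.1 env else 0) else 0)
        (fun i env => if 0 ≤ A i 0 env then F i env else 0)
    have hcomb {F : ι → (ν → ℝ) → ℝ} (hF : ∀ i, Expressible (F i)) (q) : Expressible (comb F q) := by
      rcases q with q | i
      · exact .ite_lt .zero (hA _ _) (.ite_lt (hA _ _) .zero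
          (((hA _ _).mul (hF _)).sub ((hA _ _).mul (hF _))) .zero) .zero
      · exact .ite .zero (hA _ _) (hF _) .zero
    have hsum (env : ν → ℝ) (y : Fin (d + 1) → ℝ) (q) :
        ∑ j : Fin (d + 1), comb (fun i => A i j.succ) q env * y j =
          comb (fun i env => ∑ j : Fin (d + 1), A i j.succ env * y j) q env := by
      rcases q with q | i
      · simp only [comb, Sum.elim_inl]
        split_ifs
        · simp only [sub_mul, Finset.sum_sub_distrib, Finset.mul_sum, mul_assoc]
        · simp
        · simp
      · simp only [comb, Sum.elim_inr]
        split_ifs <;> simp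
    obtain ⟨x, hx, hsol⟩ := ih (fun q j => comb (fun i => A i j.succ) q) (comb B)
      (fun q j => hcomb (fun i => hA i j.succ) q) (hcomb hB)
    have hres (i : ι) : Expressible
        (fun env => B i env - ∑ j : Fin (d + 1), A i j.succ env * x j env) :=
      (hB i).sub (.sum _ fun j _ => (hA i j.succ).mul (hx j))
    -- Given the other unknowns, the eliminated one takes its least admissible value.
    obtain ⟨x₀, hx₀, h⟩ := Expressible.exists_sup Finset.univ
      (F := fun i env => if A i 0 env < 0 then
        (B i env - ∑ j : Fin (d + 1), A i j.succ env * x j env) / A i 0 env else 0)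
      (fun i => (hA i 0).ite_lt .zero ((hres i).div (hA i 0)) .zero)
    simp only [Finset.mem_univ, true_imp_iff] at h
    refine ⟨Fin.cons x₀ x, fun j => ?_, fun env y hy hfeas => ?_⟩
    · refine Fin.cases ?_ (fun j => ?_) j
      · simpa using hx₀
      · simpa using hx j
    · simp only [Fin.sum_univ_succ (n := d + 1), Fin.cons_zero, Fin.cons_succ] at hfeas ⊢
      obtain ⟨h1, h2, h3⟩ := hsol env (fun j => y j.succ) (fun j => hy _) (by
        intro q
        rw [hsum]
        rcases q with q | i
        · simp only [comb, Sum.elim_inl]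
          split_ifs with hi hk
          · nlinarith [hfeas q.1, hfeas q.2]
          · exact le_rfl
          · exact le_rfl
        · simp only [comb, Sum.elim_inr]
          split_ifs with hi
          · linarith [hfeas i, mul_nonneg hi (hy 0)]
          · exact le_rfl)
      simp only [hsum] at h2
      refine ⟨fun j => ?_, fun i => ?_, ?_⟩
      · refine Fin.cases ?_ (fun j => ?_) j
        · simpa using ((h env _).1 le_rfl).1
        · simpa using h1 j
      · have := le_of_eliminated (h env) (fun i k hi hk => ?_) (fun i hi => ?_) i
        · linarith
        · have := h2 (.inl (i, k))
          simp only [comb, Sum.elim_inl, if_pos hi, if_pos hk] at this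
          linarith
        · have := h2 (.inr i)
          simp only [comb, Sum.elim_inr, if_pos hi] at this
          linarith
      · rw [← Fin.succ_last, Fin.cons_succ]
        exact h3

end LinearProgram

end RealRAM

namespace FreewayLocation

/-! ## The points that are reached through a freeway in a given time

The direction of the freeway is `(c, s)` with `0 ≤ s ≤ c`, and `κ` is the time that it takes to
follow the direction vector. If the freeway contains the facility, then the points with bounded
travel time form an octagon. -/

/-- The outer normals of the octagon. -/
noncomputable def normal (c s κ : ℝ) : Fin 8 → ℝ × ℝ :=
  ![(κ - s, c), (-(κ - s), -c),
    -- Common tangent of the L₁ balls below the freeway. For `c - s ≤ κ` it passes through their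
    -- right vertices and this is `c • (s, -(c - κ))`; otherwise it passes through their bottom
    -- vertices and this is `(c - κ) • (s + κ, -c)`.
    (s * c + κ * max 0 (c - s - κ), -((c - κ) * c)),
    (-(s * c + κ * max 0 (c - s - κ)), (c - κ) * c),
    (1, 1), (-1, -1), (1, -1), (-1, 1)]

/-- The growth rates of the octagon. -/
noncomputable def rate (c s κ : ℝ) : Fin 8 → ℝ :=
  ![c, c, c * (s + max 0 (c - s - κ)), c * (s + max 0 (c - s - κ)), 1, 1, 1, 1]

/-- The gain of the octagon per unit of freeway length ahead of the facility. -/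
noncomputable def gainAhead (c s κ : ℝ) : Fin 8 → ℝ :=
  ![0, 0, 0, 0, c + s - κ, 0, max 0 (c - s - κ), 0]

/-- The gain of the octagon per unit of freeway length behind the facility. -/
noncomputable def gainBehind (c s κ : ℝ) : Fin 8 → ℝ :=
  ![0, 0, 0, 0, 0, c + s - κ, 0, max 0 (c - s - κ)]

/-- The value of the linear form with coefficients `a` at the point `q`. -/
def dot (a q : ℝ × ℝ) : ℝ := a.1 * q.1 + a.2 * q.2

/-- The point `q` lies in the octagon for the time `r`, if the freeway has length `L` and extends
by `b` ahead of the facility, which is the origin. -/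
def InOctagon (c s κ L b r : ℝ) (q : ℝ × ℝ) : Prop :=
  ∀ j, dot (normal c s κ j) q ≤
    rate c s κ j * r + gainAhead c s κ j * b + gainBehind c s κ j * (L - b)

section Octagon

variable {c s κ L b r : ℝ}

theorem inOctagon_iff {q : ℝ × ℝ} : InOctagon c s κ L b r q ↔
    ((κ - s) * q.1 + c * q.2 ≤ c * r ∧ -(κ - s) * q.1 + -c * q.2 ≤ c * r) ∧
    ((s * c + κ * max 0 (c - s - κ)) * q.1 + -((c - κ) * c) * q.2 ≤
      c * (s + max 0 (c - s - κ)) * r ∧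
     -(s * c + κ * max 0 (c - s - κ)) * q.1 + (c - κ) * c * q.2 ≤
      c * (s + max 0 (c - s - κ)) * r) ∧
    (q.1 + q.2 ≤ r + (c + s - κ) * b ∧ -q.1 + -q.2 ≤ r + (c + s - κ) * (L - b)) ∧
    (q.1 + -q.2 ≤ r + max 0 (c - s - κ) * b ∧ -q.1 + q.2 ≤ r + max 0 (c - s - κ) * (L - b)) := by
  simp [InOctagon, Fin.forall_fin_succ, normal, rate, gainAhead, gainBehind, dot, and_assoc]

theorem rate_nonneg (hs : 0 ≤ s) (hc : 0 < c) (j : Fin 8) : 0 ≤ rate c s κ j := by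
  have h1 : 0 ≤ c * (s + max 0 (c - s - κ)) := by positivity
  fin_cases j <;> simp [rate, hc.le, h1]

/-- The entry point is explicit. If `κ < c - s`, riding beats walking along the first axis even when
it leads away in the second coordinate, so one enters vertically, or at the end `b` if the point is
further ahead. Otherwise one walks all the way if `y ≤ 0`, uses the end if it is passed in both
coordinates, and else enters along the first axis met, vertically above the freeway and horizontally
below it. -/
theorem exists_entry_ahead (hs : 0 ≤ s) (hc : 0 < c) {x y : ℝ} (hb : 0 ≤ b)
    (hx : 0 ≤ x) (h₁ : (κ - s) * x + c * y ≤ c * r)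
    (h₂ : (s * c + κ * max 0 (c - s - κ)) * x + -((c - κ) * c) * y ≤
      c * (s + max 0 (c - s - κ)) * r)
    (h₃ : x + y ≤ r + (c + s - κ) * b) (h₄ : x + -y ≤ r + max 0 (c - s - κ) * b) :
    ∃ l, 0 ≤ l ∧ l ≤ b ∧ |x - l * c| + |y - l * s| + κ * l ≤ r := by
  obtain ⟨l, rfl⟩ : ∃ l, x = l * c := ⟨x / c, by field_simp⟩
  have hl : 0 ≤ l := nonneg_of_mul_nonneg_left hx hc
  have h₁' : (κ - s) * l + y ≤ r := by
    refine le_of_mul_le_mul_left ?_ hc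
    linarith
  rcases le_or_gt (c - s) κ with hκ | hκ
  · rw [max_eq_left (by linarith)] at h₂ h₄
    have h₂' : s * (l * c) - (c - κ) * y ≤ s * r := by
      refine le_of_mul_le_mul_left ?_ hc
      linarith
    rcases le_or_gt y 0 with hy | hy
    · refine ⟨0, le_rfl, hb, ?_⟩
      rw [zero_mul, zero_mul, sub_zero, sub_zero, abs_of_nonneg hx, abs_of_nonpos hy]
      linarith
    · by_cases hfar : b ≤ l ∧ b * s ≤ y
      · refine ⟨b, hb, le_rfl, ?_⟩
        rw [abs_of_nonneg (by nlinarith [hfar.1]), abs_of_nonneg (by linarith [hfar.2])]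
        linarith
      · rcases le_or_gt (l * s) y with hls | hls
        · refine ⟨l, hl, ?_, ?_⟩
          · by_contra hlb
            push Not at hlb
            refine hfar ⟨hlb.le, ?_⟩
            nlinarith
          · rw [sub_self, abs_zero, abs_of_nonneg (by linarith)]
            linarith
        · have hs' : 0 < s := by
            rcases hs.eq_or_lt with rfl | h
            · linarith
            · exact h
          obtain ⟨k, rfl⟩ : ∃ k, y = k * s := ⟨y / s, by field_simp⟩
          have hk : 0 < k := pos_of_mul_pos_left hy hs
          have hkl : k < l := lt_of_mul_lt_mul_right hls hs
          refine ⟨k, hk.le, ?_, ?_⟩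
          · by_contra hkb
            push Not at hkb
            exact hfar ⟨(hkb.trans hkl).le, mul_le_mul_of_nonneg_right hkb.le hs⟩
          · rw [sub_self, abs_zero, abs_of_nonneg (by nlinarith)]
            refine le_of_mul_le_mul_left ?_ hs'
            linarith
  · rw [max_eq_right (by linarith)] at h₂ h₄
    rcases le_total l b with hlb | hlb
    · refine ⟨l, hl, hlb, ?_⟩
      rw [sub_self, abs_zero, zero_add]
      have h₂' : (s + κ) * l - y ≤ r := by
        have hcκ : 0 < c * (c - κ) := mul_pos hc (by linarith)
        refine le_of_mul_le_mul_left ?_ hcκ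
        linarith
      rcases abs_cases (y - l * s) with h | h <;> rw [h.1] <;> linarith
    · refine ⟨b, hb, le_rfl, ?_⟩
      rw [abs_of_nonneg (by nlinarith)]
      rcases abs_cases (y - b * s) with h | h <;> rw [h.1] <;> linarith

/-- Every point of the octagon is reached in time over the freeway. -/
theorem InOctagon.exists_entry (hs : 0 ≤ s) (hc : 0 < c) (hb : 0 ≤ b) (hbL : b ≤ L)
    {q : ℝ × ℝ} (h : InOctagon c s κ L b r q) :
    ∃ l, b - L ≤ l ∧ l ≤ b ∧ |q.1 - l * c| + |q.2 - l * s| + κ * |l| ≤ r := by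
  obtain ⟨⟨h0, h1⟩, ⟨h2, h3⟩, ⟨h4, h5⟩, h6, h7⟩ := inOctagon_iff.1 h
  rcases le_total 0 q.1 with hx | hx
  · obtain ⟨l, hl, hlb, h⟩ := exists_entry_ahead hs hc hb hx h0 h2 h4 h6
    exact ⟨l, by linarith, hlb, by rwa [abs_of_nonneg hl]⟩
  · obtain ⟨l, hl, hlb, h⟩ := exists_entry_ahead (x := -q.1) (y := -q.2) (κ := κ) (r := r)
      hs hc (sub_nonneg.2 hbL) (by linarith) (by linarith) (by linarith) (by linarith)
      (by linarith)
    refine ⟨-l, by linarith, by linarith, ?_⟩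
    rw [abs_neg, abs_of_nonneg hl, ← abs_neg (q.1 - -l * c), ← abs_neg (q.2 - -l * s)]
    convert h using 4 <;> ring

/-! ### Linear bounds on every path: no reachable point lies outside the octagon. -/

theorem mul_add_mul_le {a b m p q : ℝ} (ha : |a| ≤ m) (hb : |b| ≤ m) :
    a * p + b * q ≤ m * (|p| + |q|) := by
  have h1 : a * p ≤ m * |p| := (le_abs_self _).trans
    (by rw [abs_mul]; exact mul_le_mul_of_nonneg_right ha (abs_nonneg _))
  have h2 : b * q ≤ m * |q| := (le_abs_self _).trans
    (by rw [abs_mul]; exact mul_le_mul_of_nonneg_right hb (abs_nonneg _))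
  linarith

/-- A linear form with coefficients at most `m` changes by at most `m` per unit of walking, and by
`hab` also per unit of riding time. The offset `β` of the freeway from the facility cancels along
the path. -/
theorem dot_le_of_path {x y β l l' a b m : ℝ} (ha : |a| ≤ m) (hb : |b| ≤ m)
    (hab : |a * c + b * s| ≤ m * κ)
    (h : |x - l * c| + |y - β - l * s| + κ * |l - l'| + (|l' * c| + |β + l' * s|) ≤ r) :
    a * x + b * y ≤ m * r := by
  have hm : 0 ≤ m := (abs_nonneg a).trans ha
  have h1 := mul_add_mul_le (p := x - l * c) (q := y - β - l * s) ha hb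
  have h2 := mul_add_mul_le (p := l' * c) (q := β + l' * s) ha hb
  have h3 : (a * c + b * s) * (l - l') ≤ m * κ * |l - l'| := (le_abs_self _).trans
    (by rw [abs_mul]; exact mul_le_mul_of_nonneg_right hab (abs_nonneg _))
  have h4 := mul_le_mul_of_nonneg_left h hm
  linarith

/-- Only a forward ride from `l'` to `l` can beat the walking rate, by at most `g` per unit. If `l'
≥ 0`, its length is at most both `B` and `L`. If `l' < 0`, the walk between the facility and `l'`
loses `2 c |l'|`, and `g ≤ 2 c` makes this outweigh the part of the ride behind the facility. -/
theorem le_of_path_ahead {x y β l l' B η g : ℝ} (hη : 0 ≤ η) (hg : 0 ≤ g)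
    (hgη : η - κ ≤ g) (hgc : g ≤ 2 * c) (hκ : 0 < κ) {ε : ℝ} (hε : |ε| ≤ 1)
    (hηε : η = c + ε * s) (hl : l ≤ B) (hll : l - l' ≤ L)
    (h : |x - l * c| + |y - β - l * s| + κ * |l - l'| + (|l' * c| + |β + l' * s|) ≤ r) :
    x + ε * y ≤ r + g * max 0 (min B L) := by
  have hb : 0 ≤ max 0 (min B L) := le_max_left _ _
  have h1 : ε * (y - β - l * s) ≤ |y - β - l * s| := (le_abs_self _).trans
    (by rw [abs_mul]; exact mul_le_of_le_one_left (abs_nonneg _) hε)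
  have h2 : ε * (β + l' * s) ≤ |β + l' * s| := (le_abs_self _).trans
    (by rw [abs_mul]; exact mul_le_of_le_one_left (abs_nonneg _) hε)
  have h3 := le_abs_self (x - l * c)
  have h4 : x + ε * y ≤ r + η * (l - l') - κ * |l - l'| + l' * c - |l' * c| := by
    rw [hηε]; linarith
  have hgb := mul_nonneg hg hb
  have h5 := le_abs_self (l' * c)
  rcases le_total l l' with hle | hle
  · have h6 : η * (l - l') ≤ 0 := mul_nonpos_of_nonneg_of_nonpos hη (by linarith)
    have h7 := mul_nonneg hκ.le (abs_nonneg (l - l'))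
    linarith
  · rw [abs_of_nonneg (sub_nonneg.2 hle)] at h4
    have h6 : (η - κ) * (l - l') ≤ g * (l - l') :=
      mul_le_mul_of_nonneg_right hgη (sub_nonneg.2 hle)
    rcases le_total 0 l' with hl' | hl'
    · have h7 : g * (l - l') ≤ g * max 0 (min B L) :=
        mul_le_mul_of_nonneg_left (le_max_of_le_right (le_min (by linarith) hll)) hg
      linarith
    · have h7 : g * l ≤ g * max 0 (min B L) :=
        mul_le_mul_of_nonneg_left (le_max_of_le_right (le_min hl (by linarith))) hg
      have h8 := neg_le_abs (l' * c)
      have h9 : 0 ≤ (2 * c - g) * -l' := mul_nonneg (by linarith) (by linarith)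
      linarith

/-- Whether or not the facility lies on the freeway, the points that are reached in time over the
freeway lie in the octagon for a suitable position on the freeway. -/
theorem inOctagon_of_path (hs : 0 ≤ s) (hsc : s ≤ c) (hc : 0 < c) (hκ : 0 < κ) (hκc : κ < c + s)
    {q : ℝ × ℝ} {β l l' B : ℝ} (hl₁ : B - L ≤ l) (hl₂ : l ≤ B) (hl₁' : B - L ≤ l') (hl₂' : l' ≤ B)
    (h : |q.1 - l * c| + |q.2 - β - l * s| + κ * |l - l'| + (|l' * c| + |β + l' * s|) ≤ r) :
    InOctagon c s κ L (max 0 (min B L)) r q := by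
  have hL : 0 ≤ L := by linarith
  set δ := max 0 (c - s - κ) with hδ
  have hδ0 : 0 ≤ δ := le_max_left _ _
  have hδ1 : c - s - κ ≤ δ := le_max_right _ _
  have hδ2 : δ ≤ 2 * c := max_le (by linarith) (by linarith)
  -- Clamping to `[0, L]` commutes with reversing the freeway, so the bounds behind the facility
  -- follow from those ahead by reflection in the origin.
  have hsub : L - max 0 (min B L) = max 0 (min (L - B) L) := by
    rcases le_total B 0 with h1 | h1
    · rw [min_eq_left (by linarith : B ≤ L), max_eq_left h1, min_eq_right (by linarith),
        max_eq_right hL, sub_zero]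
    · rcases le_total B L with h2 | h2
      · rw [min_eq_left h2, max_eq_right h1, min_eq_left (by linarith),
          max_eq_right (by linarith)]
      · rw [min_eq_right h2, max_eq_right hL, min_eq_left (by linarith),
          max_eq_left (by linarith), sub_self]
  have h' : |-q.1 - -l * c| + |-q.2 - -β - -l * s| + κ * |-l - -l'| +
      (|-l' * c| + |-β + -l' * s|) ≤ r := by
    refine le_trans (le_of_eq ?_) h
    rw [← abs_neg (-q.1 - -l * c), ← abs_neg (-q.2 - -β - -l * s), ← abs_neg (-l - -l'),
      ← abs_neg (-l' * c), ← abs_neg (-β + -l' * s)]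
    ring_nf
  have ha : |κ - s| ≤ c := abs_le.2 ⟨by linarith, by linarith⟩
  have hb : |c| ≤ c := (abs_of_pos hc).le
  have hab : |(κ - s) * c + c * s| ≤ c * κ := by
    rw [show (κ - s) * c + c * s = c * κ by ring, abs_of_pos (mul_pos hc hκ)]
  have hδ3 : κ * δ ≤ c * δ := by
    rcases le_total κ c with h1 | h1
    · exact mul_le_mul_of_nonneg_right h1 hδ0
    · rw [hδ, max_eq_left (by linarith), mul_zero, mul_zero]
  have ha' : |s * c + κ * δ| ≤ c * (s + δ) := by
    rw [abs_of_nonneg (by positivity)]; linarith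
  have hb' : |-((c - κ) * c)| ≤ c * (s + δ) := by
    rw [abs_neg, abs_mul, abs_of_pos hc, mul_comm]
    exact mul_le_mul_of_nonneg_left (abs_le.2 ⟨by linarith, by linarith⟩) hc.le
  have hab' : |(s * c + κ * δ) * c + -((c - κ) * c) * s| ≤ c * (s + δ) * κ := by
    rw [show (s * c + κ * δ) * c + -((c - κ) * c) * s = c * (s + δ) * κ by ring,
      abs_of_nonneg (by positivity)]
  have one : |(1 : ℝ)| ≤ 1 := by simp
  have neg_one : |(-1 : ℝ)| ≤ 1 := by simp
  refine inOctagon_iff.2 ⟨⟨dot_le_of_path ha hb hab h, ?_⟩, ⟨dot_le_of_path ha' hb' hab' h, ?_⟩,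
    ⟨?_, ?_⟩, ?_, ?_⟩
  · have := dot_le_of_path ha hb hab h'
    linarith
  · have := dot_le_of_path ha' hb' hab' h'
    linarith
  · have := le_of_path_ahead (g := c + s - κ) (ε := 1) (add_nonneg hc.le hs) (by linarith)
      le_rfl (by linarith) hκ one (by ring) hl₂ (by linarith : l - l' ≤ L) h
    linarith
  · rw [hsub]
    have := le_of_path_ahead (g := c + s - κ) (ε := 1) (add_nonneg hc.le hs) (by linarith)
      le_rfl (by linarith) hκ one (by ring) (by linarith : -l ≤ L - B)
      (by linarith : -l - -l' ≤ L) h'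
    linarith
  · have := le_of_path_ahead (η := c - s) (ε := -1) (by linarith) hδ0
      hδ1 hδ2 hκ neg_one (by ring) hl₂ (by linarith : l - l' ≤ L) h
    linarith
  · rw [hsub]
    have := le_of_path_ahead (η := c - s) (ε := -1) (by linarith) hδ0
      hδ1 hδ2 hκ neg_one (by ring) (by linarith : -l ≤ L - B)
      (by linarith : -l - -l' ≤ L) h'
    linarith

/-- Walking is a path over a freeway of length `0` at the facility, and lengthening the freeway only
enlarges the octagon. -/
theorem inOctagon_of_walk (hs : 0 ≤ s) (hsc : s ≤ c) (hc : 0 < c) (hκ : 0 < κ) (hκc : κ < c + s)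
    (hb : 0 ≤ b) (hbL : b ≤ L) {q : ℝ × ℝ} (h : |q.1| + |q.2| ≤ r) :
    InOctagon c s κ L b r q := by
  have hr : InOctagon c s κ 0 (max 0 (min 0 0)) r q :=
    inOctagon_of_path (β := 0) (l := 0) (l' := 0) (B := 0) hs hsc hc hκ hκc (by simp) le_rfl
      (by simp) le_rfl (by simpa using h)
  obtain ⟨h1, h2, ⟨h4, h5⟩, h6, h7⟩ := inOctagon_iff.1 hr
  simp only [min_self, max_self, mul_zero, sub_self, add_zero] at h4 h5 h6 h7
  have hδ0 : 0 ≤ max 0 (c - s - κ) := le_max_left _ _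
  have e1 := mul_nonneg (sub_pos.2 hκc).le hb
  have e2 := mul_nonneg (sub_pos.2 hκc).le (sub_nonneg.2 hbL)
  have e3 := mul_nonneg hδ0 hb
  have e4 := mul_nonneg hδ0 (sub_nonneg.2 hbL)
  exact inOctagon_iff.2 ⟨h1, h2, ⟨by linarith, by linarith⟩, by linarith, by linarith⟩

/-- The octagon is closed with respect to time. -/
theorem inOctagon_of_forall_pos_add (hs : 0 ≤ s) (hc : 0 < c) {q : ℝ × ℝ}
    (h : ∀ ε > 0, InOctagon c s κ L b (r + ε) q) : InOctagon c s κ L b r q := by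
  intro j
  by_contra! hj
  have ha := rate_nonneg (κ := κ) hs hc j
  set X := dot (normal c s κ j) q
  set a := rate c s κ j
  set k := gainAhead c s κ j * b + gainBehind c s κ j * (L - b) with hk
  obtain ⟨ε, hε⟩ : ∃ ε, ε * (a + 1) = X - a * r - k :=
    ⟨(X - a * r - k) / (a + 1), by field_simp⟩
  have hε0 : 0 < ε := pos_of_mul_pos_left (b := a + 1) (by rw [hε]; linarith) (by linarith)
  have := h ε hε0 j
  linarith

end Octagon

/-! ## Reduction to directions between the first axis and the diagonal -/

/-- The sign of a real number; zero counts as positive. -/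
noncomputable def sgn (x : ℝ) : ℝ := if 0 ≤ x then 1 else -1

theorem sgn_mul_self (x : ℝ) : sgn x * x = |x| := by
  unfold sgn
  split_ifs with h
  · rw [one_mul, abs_of_nonneg h]
  · rw [neg_one_mul, abs_of_neg (not_le.1 h)]

theorem sgn_mul_sgn (x y : ℝ) : sgn x * (sgn x * y) = y := by
  unfold sgn
  split_ifs <;> ring

theorem abs_sgn_mul (x y : ℝ) : |sgn x * y| = |y| := by
  unfold sgn
  split_ifs <;> simp

/-- The symmetry of the square that maps the direction `e` to one between the first axis and the
diagonal. -/
noncomputable def turn (e q : ℝ × ℝ) : ℝ × ℝ :=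
  if |e.2| ≤ |e.1| then (sgn e.1 * q.1, sgn e.2 * q.2) else (sgn e.2 * q.2, sgn e.1 * q.1)

/-- The inverse of `turn`. -/
noncomputable def unturn (e q : ℝ × ℝ) : ℝ × ℝ :=
  if |e.2| ≤ |e.1| then (sgn e.1 * q.1, sgn e.2 * q.2) else (sgn e.1 * q.2, sgn e.2 * q.1)

theorem turn_unturn (e q : ℝ × ℝ) : turn e (unturn e q) = q := by
  unfold turn unturn
  split_ifs <;> simp [sgn_mul_sgn]

theorem turn_sub (e q q' : ℝ × ℝ) : turn e (q - q') = turn e q - turn e q' := by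
  unfold turn
  split_ifs <;> ext <;> simp <;> ring

theorem turn_add (e q q' : ℝ × ℝ) : turn e (q + q') = turn e q + turn e q' := by
  unfold turn
  split_ifs <;> ext <;> simp <;> ring

theorem turn_smul (e q : ℝ × ℝ) (l : ℝ) : turn e (l • q) = l • turn e q := by
  unfold turn
  split_ifs <;> ext <;> simp <;> ring

theorem abs_turn (e q : ℝ × ℝ) : |(turn e q).1| + |(turn e q).2| = |q.1| + |q.2| := by
  unfold turn
  split_ifs
  · simp only [abs_sgn_mul]
  · simp only [abs_sgn_mul, add_comm]

theorem turn_self (e : ℝ × ℝ) : turn e e = (max |e.1| |e.2|, min |e.1| |e.2|) := by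
  unfold turn
  split_ifs with h
  · simp [sgn_mul_self, h]
  · simp [sgn_mul_self, (not_le.1 h).le]

/-- This invariance is what allows the direction to be taken between the first axis and the
diagonal. -/
theorem l1Dist_eq_turn (e q q' : ℝ × ℝ) :
    l1Dist q q' = |(turn e (q - q')).1| + |(turn e (q - q')).2| := by
  rw [abs_turn]; rfl

end FreewayLocation

namespace FreewayLocation

/-! ## Travel times over freeways of a given direction -/

/-- Along lines of direction `e`, the function `ρ` is `w` times the distance of the parameters,
where `w` is at most the `L₁` norm of `e`. -/
structure UniformAlong (ρ : ℝ × ℝ → ℝ × ℝ → ℝ) (w : ℝ) (e : ℝ × ℝ) : Prop where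
  dist_eq (q : ℝ × ℝ) (l l' : ℝ) : ρ (q + l • e) (q + l' • e) = w * |l - l'|
  pos : 0 < w
  le : w ≤ |e.1| + |e.2|

theorem uniformAlong_l1Dist {e : ℝ × ℝ} (he : e.1 ^ 2 + e.2 ^ 2 = 1) :
    UniformAlong l1Dist (|e.1| + |e.2|) e where
  dist_eq q l l' := by
    simp only [l1Dist, Prod.fst_add, Prod.snd_add, Prod.smul_fst, Prod.smul_snd, smul_eq_mul,
      add_sub_add_left_eq_sub, ← sub_mul, abs_mul]
    ring
  pos := by
    by_contra! h
    have h1 := abs_nonneg e.1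
    have h2 := abs_nonneg e.2
    have h3 : e.1 = 0 := abs_eq_zero.1 (by linarith)
    have h4 : e.2 = 0 := abs_eq_zero.1 (by linarith)
    norm_num [h3, h4] at he
  le := le_rfl

theorem uniformAlong_l2Dist {e : ℝ × ℝ} (he : e.1 ^ 2 + e.2 ^ 2 = 1) :
    UniformAlong l2Dist 1 e where
  dist_eq q l l' := by
    simp only [l2Dist, Prod.fst_add, Prod.snd_add, Prod.smul_fst, Prod.smul_snd, smul_eq_mul,
      add_sub_add_left_eq_sub, ← sub_mul, mul_pow, ← mul_add, he, mul_one, one_mul,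
      Real.sqrt_sq_eq_abs]
  pos := one_pos
  le := by
    have h1 := abs_nonneg e.1
    have h2 := abs_nonneg e.2
    rw [← sq_abs e.1, ← sq_abs e.2] at he
    nlinarith

section TravelTime

variable {ρ : ℝ × ℝ → ℝ × ℝ → ℝ} {w v : ℝ} {e : ℝ × ℝ}

theorem l1Dist_nonneg (p q : ℝ × ℝ) : 0 ≤ l1Dist p q := by
  unfold l1Dist; positivity

theorem add_smul_mem_segment (f e : ℝ × ℝ) {a b l : ℝ} (h : a < b) (ha : a ≤ l) (hb : l ≤ b) :
    f + l • e ∈ segment ℝ (f + a • e) (f + b • e) := by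
  have hba : 0 < b - a := sub_pos.2 h
  refine ⟨(b - l) / (b - a), (l - a) / (b - a), div_nonneg (by linarith) hba.le,
    div_nonneg (by linarith) hba.le, by field_simp; ring, ?_⟩
  ext <;> simp <;> field_simp <;> ring

theorem exists_of_mem_segment {u u' e q : ℝ × ℝ} {r : ℝ} (h : u' - u = r • e)
    (hq : q ∈ segment ℝ u u') :
    ∃ l, min 0 r ≤ l ∧ l ≤ max 0 r ∧ q = u + l • e := by
  rw [segment_eq_image'] at hq
  obtain ⟨θ, ⟨h0, h1⟩, rfl⟩ := hq
  refine ⟨θ * r, ?_, ?_, by rw [h, mul_smul]⟩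
  · rcases le_total 0 r with hr | hr
    · rw [min_eq_left hr]; positivity
    · rw [min_eq_right hr]; nlinarith
  · rcases le_total 0 r with hr | hr
    · rw [max_eq_right hr]; nlinarith
    · rw [max_eq_left hr]; exact mul_nonpos_of_nonneg_of_nonpos h0 hr

/-- The travel times over a freeway through the facility. -/
theorem travelTime_le_of_entry (hρ : UniformAlong ρ w e) (hv : 1 < v) {a b l r : ℝ}
    (hab : a < b) (ha : a ≤ 0) (hb : 0 ≤ b) (hal : a ≤ l) (hlb : l ≤ b) {p f : ℝ × ℝ}
    (h : l1Dist p (f + l • e) + w / v * |l| ≤ r) :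
    travelTime ρ v (f + a • e) (f + b • e) p f ≤ r := by
  -- The freeway is left at the facility itself, so the last walk has length `0`.
  refine (min_le_right _ _).trans ((ciInf_le ?_ (⟨f + l • e, add_smul_mem_segment f e hab hal hlb⟩,
    ⟨f, by simpa using add_smul_mem_segment f e hab ha hb⟩)).trans ?_)
  · refine ⟨0, ?_⟩
    rintro _ ⟨⟨⟨s, hs⟩, ⟨s', hs'⟩⟩, rfl⟩
    have hdir : f + b • e - (f + a • e) = (b - a) • e := by rw [sub_smul]; abel
    obtain ⟨k, -, -, rfl⟩ := exists_of_mem_segment hdir hs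
    obtain ⟨k', -, -, rfl⟩ := exists_of_mem_segment hdir hs'
    simp only [hρ.dist_eq]
    have := hρ.pos
    have h1 := l1Dist_nonneg p (f + a • e + k • e)
    have h2 := l1Dist_nonneg (f + a • e + k' • e) f
    positivity
  · have h1 := hρ.dist_eq f l 0
    rw [zero_smul, add_zero, sub_zero] at h1
    have h2 : l1Dist f f = 0 := by simp [l1Dist]
    simp only [h1, h2]
    rw [add_zero, mul_div_right_comm]
    exact h

theorem travelTime_le_l1Dist (t t' p f : ℝ × ℝ) : travelTime ρ v t t' p f ≤ l1Dist p f :=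
  min_le_left _ _

/-- The larger absolute value of the coordinates. -/
noncomputable def major (e : ℝ × ℝ) : ℝ := max |e.1| |e.2|

/-- The smaller absolute value of the coordinates. -/
noncomputable def minor (e : ℝ × ℝ) : ℝ := min |e.1| |e.2|

theorem minor_nonneg (e : ℝ × ℝ) : 0 ≤ minor e := le_min (abs_nonneg _) (abs_nonneg _)

theorem minor_le_major (e : ℝ × ℝ) : minor e ≤ major e := min_le_max

theorem UniformAlong.major_pos (hρ : UniformAlong ρ w e) : 0 < major e := by
  have h1 := hρ.pos.trans_le hρ.le
  have h2 : major e + minor e = |e.1| + |e.2| := max_add_min _ _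
  linarith [minor_le_major e]

theorem UniformAlong.div_pos (hρ : UniformAlong ρ w e) (hv : 1 < v) : 0 < w / v :=
  _root_.div_pos hρ.pos (by linarith)

theorem UniformAlong.div_lt (hρ : UniformAlong ρ w e) (hv : 1 < v) :
    w / v < major e + minor e := by
  have h2 : major e + minor e = |e.1| + |e.2| := max_add_min _ _
  rw [h2]
  exact (div_lt_self hρ.pos hv).trans_le hρ.le

theorem l1Dist_add_smul (p f e : ℝ × ℝ) (l : ℝ) : l1Dist p (f + l • e) =
    |(turn e (p - f)).1 - l * major e| + |(turn e (p - f)).2 - l * minor e| := by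
  rw [l1Dist_eq_turn e, ← sub_sub, turn_sub, turn_smul, turn_self]
  rfl

theorem travelTime_le_of_inOctagon (hρ : UniformAlong ρ w e) (hv : 1 < v) {L b r : ℝ}
    (hL : 0 < L) (hb : 0 ≤ b) (hbL : b ≤ L) {p f : ℝ × ℝ}
    (h : InOctagon (major e) (minor e) (w / v) L b r (turn e (p - f))) :
    travelTime ρ v (f + (b - L) • e) (f + b • e) p f ≤ r := by
  obtain ⟨l, h1, h2, h3⟩ := h.exists_entry (minor_nonneg e) hρ.major_pos hb hbL
  refine travelTime_le_of_entry hρ hv (by linarith) (by linarith) hb h1 h2 ?_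
  rwa [l1Dist_add_smul]

/-- For every facility and every freeway, the travel times are bounded from below by those over a
freeway of the same length through the facility. -/
theorem exists_inOctagon (hρ : UniformAlong ρ w e) (hv : 1 < v) (g : ℝ × ℝ) {u u' : ℝ × ℝ}
    {r₀ : ℝ} (hu : u' - u = r₀ • e) :
    ∃ b, 0 ≤ b ∧ b ≤ |r₀| ∧ ∀ p R, travelTime ρ v u u' p g ≤ R →
      InOctagon (major e) (minor e) (w / v) |r₀| b R (turn e (p - g)) := by
  have hc := hρ.major_pos
  set z := turn e (u - g) with hz
  -- Parameters along the freeway are measured so that parameter `0` has the same first turned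
  -- coordinate as the facility. Then `u` has parameter `l₀` and the front end has `B`; `r₀` may be
  -- negative.
  obtain ⟨l₀, hl₀⟩ : ∃ l₀, l₀ * major e = z.1 := ⟨z.1 / major e, by field_simp⟩
  set B := l₀ + max 0 r₀ with hB
  have hBr : B - |r₀| = l₀ + min 0 r₀ := by
    rcases le_total 0 r₀ with h | h
    · rw [hB, max_eq_right h, min_eq_left h, abs_of_nonneg h]; ring
    · rw [hB, max_eq_left h, min_eq_right h, abs_of_nonpos h]; ring
  have hb0 : 0 ≤ max 0 (min B |r₀|) := le_max_left _ _
  have hbL : max 0 (min B |r₀|) ≤ |r₀| := max_le (abs_nonneg _) (min_le_right _ _)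
  -- The freeway is moved parallel to the second turned axis onto the line through the facility,
  -- then along itself just until it contains the facility. This does not depend on `p` or `R`.
  refine ⟨max 0 (min B |r₀|), hb0, hbL, fun p R hR => ?_⟩
  -- The infimum over pairs of freeway points is not shown to be attained, so a path is taken that
  -- costs less than `R + ε`.
  refine inOctagon_of_forall_pos_add (minor_nonneg e) hc fun ε hε => ?_
  rcases min_lt_iff.1 (lt_of_le_of_lt hR (lt_add_of_pos_right R hε)) with h | h
  · refine inOctagon_of_walk (minor_nonneg e) (minor_le_major e) hc (hρ.div_pos hv)
      (hρ.div_lt hv) hb0 hbL ?_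
    rw [abs_turn]
    exact h.le
  · have : Nonempty (segment ℝ u u' × segment ℝ u u') :=
      ⟨⟨u, left_mem_segment ℝ u u'⟩, ⟨u, left_mem_segment ℝ u u'⟩⟩
    obtain ⟨⟨⟨s, hs⟩, ⟨s', hs'⟩⟩, h⟩ := exists_lt_of_ciInf_lt h
    obtain ⟨k, hk1, hk2, rfl⟩ := exists_of_mem_segment hu hs
    obtain ⟨k', hk1', hk2', rfl⟩ := exists_of_mem_segment hu hs'
    refine inOctagon_of_path (β := z.2 - l₀ * minor e) (l := l₀ + k) (l' := l₀ + k')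
      (minor_nonneg e) (minor_le_major e) hc (hρ.div_pos hv) (hρ.div_lt hv)
      (by linarith) (by linarith) (by linarith) (by linarith) ?_
    refine le_trans (le_of_eq ?_) h.le
    have h1 : turn e (u + k' • e - g) = z + k' • (major e, minor e) := by
      rw [add_sub_right_comm, turn_add, turn_smul, turn_self]; rfl
    have h2 : turn e (p - u) = turn e (p - g) - z := by
      rw [hz, ← turn_sub, sub_sub_sub_cancel_right]
    simp only [hρ.dist_eq]
    rw [l1Dist_add_smul, l1Dist_eq_turn e _ g, h1, h2]
    simp only [Prod.fst_add, Prod.snd_add, Prod.smul_fst, Prod.smul_snd, smul_eq_mul,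
      Prod.fst_sub, Prod.snd_sub, ← hl₀]
    ring_nf

theorem maxTravelTime_le_iff {n : ℕ} (hn : 1 ≤ n) {p : Fin n → ℝ × ℝ} {f t t' : ℝ × ℝ} {r : ℝ} :
    maxTravelTime ρ v p f t t' ≤ r ↔ ∀ i, travelTime ρ v t t' (p i) f ≤ r := by
  have : Nonempty (Fin n) := ⟨⟨0, hn⟩⟩
  exact ciSup_le_iff (Set.finite_range _).bddAbove

end TravelTime

/-! ## The linear program -/

open RealRAM

section Expressible

variable {ν : Type} {c s κ L : (ν → ℝ) → ℝ}

theorem expressible_normal (hc : Expressible c) (hs : Expressible s) (hκ : Expressible κ)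
    (j : Fin 8) :
    Expressible (fun env => (normal (c env) (s env) (κ env) j).1) ∧
      Expressible (fun env => (normal (c env) (s env) (κ env) j).2) := by
  have hδ := Expressible.zero.max ((hc.sub hs).sub hκ)
  have ha := (hs.mul hc).add (hκ.mul hδ)
  have hb := (hc.sub hκ).mul hc
  fin_cases j
  · exact ⟨hκ.sub hs, hc⟩
  · exact ⟨(hκ.sub hs).neg, hc.neg⟩
  · exact ⟨ha, hb.neg⟩
  · exact ⟨ha.neg, hb⟩
  · exact ⟨.one, .one⟩
  · exact ⟨Expressible.one.neg, Expressible.one.neg⟩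
  · exact ⟨.one, Expressible.one.neg⟩
  · exact ⟨Expressible.one.neg, .one⟩

theorem expressible_rate (hc : Expressible c) (hs : Expressible s) (hκ : Expressible κ)
    (j : Fin 8) : Expressible (fun env => rate (c env) (s env) (κ env) j) := by
  have hδ := Expressible.zero.max ((hc.sub hs).sub hκ)
  fin_cases j
  · exact hc
  · exact hc
  · exact hc.mul (hs.add hδ)
  · exact hc.mul (hs.add hδ)
  all_goals exact .one

theorem expressible_gain (hc : Expressible c) (hs : Expressible s) (hκ : Expressible κ)
    (j : Fin 8) :
    Expressible (fun env => gainAhead (c env) (s env) (κ env) j) ∧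
      Expressible (fun env => gainBehind (c env) (s env) (κ env) j) := by
  have hδ := Expressible.zero.max ((hc.sub hs).sub hκ)
  have hγ := (hc.add hs).sub hκ
  fin_cases j
  · exact ⟨.zero, .zero⟩
  · exact ⟨.zero, .zero⟩
  · exact ⟨.zero, .zero⟩
  · exact ⟨.zero, .zero⟩
  · exact ⟨hγ, .zero⟩
  · exact ⟨.zero, hγ⟩
  · exact ⟨hδ, .zero⟩
  · exact ⟨.zero, hδ⟩

/-- The smallest octagon that contains the clients is given by terms. -/
theorem exists_expressible_octagon (hc : Expressible c) (hs : Expressible s) (hκ : Expressible κ)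
    (hL : Expressible L) {M : Fin 8 → (ν → ℝ) → ℝ} (hM : ∀ j, Expressible (M j)) :
    ∃ X Y b r : (ν → ℝ) → ℝ, (Expressible X ∧ Expressible Y ∧ Expressible b) ∧
      ∀ env (F : ℝ × ℝ) (b' r' : ℝ), 0 ≤ b' → b' ≤ L env → 0 ≤ r' →
        (∀ j, M j env ≤ dot (normal (c env) (s env) (κ env) j) F +
          (rate (c env) (s env) (κ env) j * r' +
          gainAhead (c env) (s env) (κ env) j * b' +
          gainBehind (c env) (s env) (κ env) j * (L env - b'))) →
        0 ≤ b env ∧ b env ≤ L env ∧ r env ≤ r' ∧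
        ∀ j, M j env ≤ dot (normal (c env) (s env) (κ env) j) (X env, Y env) +
          (rate (c env) (s env) (κ env) j * r env +
          gainAhead (c env) (s env) (κ env) j * b env +
          gainBehind (c env) (s env) (κ env) j * (L env - b env)) := by
  have hn := expressible_normal hc hs hκ
  have hr := expressible_rate hc hs hκ
  have hg := expressible_gain hc hs hκ
  -- The six nonnegative unknowns are the positive and negative parts of both facility coordinates,
  -- then `b`, and last `r`, which is minimized. The row `none` says that `b` is at most the length.
  let A : Option (Fin 8) → Fin 6 → (ν → ℝ) → ℝ
    | none => ![fun _ => 0, fun _ => 0, fun _ => 0, fun _ => 0, fun _ => 1, fun _ => 0]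
    | some j => ![fun env => -(normal (c env) (s env) (κ env) j).1,
        fun env => (normal (c env) (s env) (κ env) j).1,
        fun env => -(normal (c env) (s env) (κ env) j).2,
        fun env => (normal (c env) (s env) (κ env) j).2,
        fun env => gainBehind (c env) (s env) (κ env) j - gainAhead (c env) (s env) (κ env) j,
        fun env => -rate (c env) (s env) (κ env) j]
  let B : Option (Fin 8) → (ν → ℝ) → ℝ
    | none => L
    | some j => fun env => gainBehind (c env) (s env) (κ env) j * L env - M j env
  obtain ⟨x, hx, hsol⟩ := exists_expressible_solution 5 A B
    (by
      rintro (_ | j) i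
      · fin_cases i
        · exact .zero
        · exact .zero
        · exact .zero
        · exact .zero
        · exact .one
        · exact .zero
      · fin_cases i
        · exact (hn j).1.neg
        · exact (hn j).1
        · exact (hn j).2.neg
        · exact (hn j).2
        · exact (hg j).2.sub (hg j).1
        · exact (hr j).neg)
    (by
      rintro (_ | j)
      · exact hL
      · exact ((hg j).2.mul hL).sub (hM j))
  refine ⟨fun env => x 0 env - x 1 env, fun env => x 2 env - x 3 env, x 4, x 5,
    ⟨(hx 0).sub (hx 1), (hx 2).sub (hx 3), hx 4⟩, fun env F b' r' hb0 hbL hr0 hfeas => ?_⟩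
  have hpart (z : ℝ) : max z 0 - max (-z) 0 = z := max_zero_sub_max_neg_zero_eq_self z
  have hsum (f : Fin (5 + 1) → ℝ) : ∑ j, f j = f 0 + f 1 + f 2 + f 3 + f 4 + f 5 :=
    Fin.sum_univ_six f
  obtain ⟨h1, h2, h3⟩ := hsol env
    ![max F.1 0, max (-F.1) 0, max F.2 0, max (-F.2) 0, b', r']
    (by simp [Fin.forall_fin_succ, hb0, hr0])
    (by
      rintro (_ | j)
      · simpa [A, B, Fin.sum_univ_succ] using hbL
      · have := hfeas j
        simp only [dot] at this
        rw [← hpart F.1, ← hpart F.2] at this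
        simp only [A, B, hsum, Matrix.cons_val]
        linarith)
  have h4 := h2 none
  simp only [A, B, hsum, Matrix.cons_val, zero_mul, one_mul, add_zero, zero_add] at h4
  refine ⟨h1 4, h4, by simpa using h3, fun j => ?_⟩
  have h5 := h2 (some j)
  simp only [A, B, hsum, Matrix.cons_val] at h5
  simp only [dot]
  linarith

/-! ### The symmetry of the square and its inverse as terms. -/

theorem expressible_sgn {f : (ν → ℝ) → ℝ} (hf : Expressible f) :
    Expressible (fun env => sgn (f env)) :=
  .ite .zero hf .one Expressible.one.neg

theorem expressible_turn {e₁ e₂ x y : (ν → ℝ) → ℝ} (h₁ : Expressible e₁) (h₂ : Expressible e₂)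
    (hx : Expressible x) (hy : Expressible y) :
    Expressible (fun env => (turn (e₁ env, e₂ env) (x env, y env)).1) ∧
      Expressible (fun env => (turn (e₁ env, e₂ env) (x env, y env)).2) := by
  simp only [turn, apply_ite Prod.fst, apply_ite Prod.snd]
  exact ⟨.ite h₂.abs h₁.abs ((expressible_sgn h₁).mul hx) ((expressible_sgn h₂).mul hy),
    .ite h₂.abs h₁.abs ((expressible_sgn h₂).mul hy) ((expressible_sgn h₁).mul hx)⟩

theorem expressible_unturn {e₁ e₂ x y : (ν → ℝ) → ℝ} (h₁ : Expressible e₁) (h₂ : Expressible e₂)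
    (hx : Expressible x) (hy : Expressible y) :
    Expressible (fun env => (unturn (e₁ env, e₂ env) (x env, y env)).1) ∧
      Expressible (fun env => (unturn (e₁ env, e₂ env) (x env, y env)).2) := by
  simp only [unturn, apply_ite Prod.fst, apply_ite Prod.snd]
  exact ⟨.ite h₂.abs h₁.abs ((expressible_sgn h₁).mul hx) ((expressible_sgn h₁).mul hy),
    .ite h₂.abs h₁.abs ((expressible_sgn h₂).mul hy) ((expressible_sgn h₂).mul hx)⟩

end Expressible

end FreewayLocation

namespace FreewayLocation

open RealRAM

/-! ## The algorithm -/

section Algorithm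

variable {ρ : ℝ × ℝ → ℝ × ℝ → ℝ}

/-- The pair of a facility and a freeway of direction `e` and length `L` is optimal among all such
pairs. -/
def SolvesLength (ρ : ℝ × ℝ → ℝ × ℝ → ℝ) (v : ℝ) (e : ℝ × ℝ) (L : ℝ) {n : ℕ} (p : Fin n → ℝ × ℝ)
    (f t t' : ℝ × ℝ) : Prop :=
  IsOptimal ρ v p (fun u u' => ∃ r : ℝ, |r| = L ∧ u' - u = r • e) f t t'

/-- All clients lie in a translated octagon exactly when eight support values do not exceed its
offsets, so the clients enter only through the maxima `M`. -/
theorem le_dot_add_iff_inOctagon {n : ℕ} {p : Fin n → ℝ × ℝ} {c s κ L b r : ℝ} {e F : ℝ × ℝ}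
    {M : Fin 8 → ℝ} (hM : ∀ j z, M j ≤ z ↔ ∀ i, dot (normal c s κ j) (turn e (p i)) ≤ z) :
    (∀ j, M j ≤ dot (normal c s κ j) F + (rate c s κ j * r + gainAhead c s κ j * b +
      gainBehind c s κ j * (L - b))) ↔ ∀ i, InOctagon c s κ L b r (turn e (p i) - F) := by
  have hdot (a q q' : ℝ × ℝ) : dot a (q - q') = dot a q - dot a q' := by
    simp only [dot, Prod.fst_sub, Prod.snd_sub]; ring
  simp only [hM, InOctagon, hdot, sub_le_iff_le_add']
  exact forall_comm

/-- Needed because the minimized unknown of the linear program is restricted to nonnegative values,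
so each competitor must give such a value. -/
theorem maxTravelTime_nonneg {w v : ℝ} {e : ℝ × ℝ} (hρ : UniformAlong ρ w e) (hv : 1 < v) {n : ℕ}
    (hn : 1 ≤ n) (p : Fin n → ℝ × ℝ) (g : ℝ × ℝ) {u u' : ℝ × ℝ} {r₀ : ℝ}
    (hu : u' - u = r₀ • e) : 0 ≤ maxTravelTime ρ v p g u u' := by
  refine le_trans ?_ ((maxTravelTime_le_iff hn).1 le_rfl ⟨0, hn⟩)
  refine le_min (l1Dist_nonneg _ _) (Real.iInf_nonneg ?_)
  rintro ⟨⟨s, hs⟩, ⟨s', hs'⟩⟩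
  obtain ⟨k, -, -, rfl⟩ := exists_of_mem_segment hu hs
  obtain ⟨k', -, -, rfl⟩ := exists_of_mem_segment hu hs'
  simp only [hρ.dist_eq]
  have := hρ.pos
  have h1 := l1Dist_nonneg (p ⟨0, hn⟩) (u + k • e)
  have h2 := l1Dist_nonneg (u + k' • e) g
  positivity

/-- A smallest octagon that contains the clients yields an optimal facility and freeway. -/
theorem solvesLength_of_octagon {w v : ℝ} {e : ℝ × ℝ} (hρ : UniformAlong ρ w e) (hv : 1 < v)
    {n : ℕ} (hn : 1 ≤ n) {p : Fin n → ℝ × ℝ} {L b r : ℝ} (hL : 0 < L) {f : ℝ × ℝ}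
    (hfeas : 0 ≤ b ∧ b ≤ L ∧
      ∀ i, InOctagon (major e) (minor e) (w / v) L b r (turn e (p i) - turn e f))
    (hmin : ∀ (F : ℝ × ℝ) (b' r' : ℝ), 0 ≤ b' → b' ≤ L → 0 ≤ r' →
      (∀ i, InOctagon (major e) (minor e) (w / v) L b' r' (turn e (p i) - F)) → r ≤ r') :
    SolvesLength ρ v e L p f (f + (b - L) • e) (f + b • e) := by
  obtain ⟨hb, hbL, hoct⟩ := hfeas
  refine ⟨⟨L, abs_of_pos hL, by rw [sub_smul]; abel⟩, ?_⟩
  rintro g u u' ⟨r₀, rfl, hu⟩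
  obtain ⟨b', hb', hbL', h⟩ := exists_inOctagon hρ hv g hu
  refine le_trans ((maxTravelTime_le_iff hn).2 fun i =>
    travelTime_le_of_inOctagon hρ hv hL hb hbL ?_) (hmin (turn e g) b' _ hb' hbL'
      (maxTravelTime_nonneg hρ hv hn p g hu) fun i => ?_)
  · rw [turn_sub]; exact hoct i
  · rw [← turn_sub]
    exact h _ _ ((maxTravelTime_le_iff hn).1 le_rfl i)

/-- There is a linear time program that solves the problem for a length that is given by a term in
the input and in maxima over the clients, in particular the maximum of their `L₁` norms. -/
theorem exists_program (w : ℝ → ℝ → ℝ)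
    (hw : ∀ {ν : Type} {f g : (ν → ℝ) → ℝ}, Expressible f → Expressible g →
      Expressible fun env => w (f env) (g env))
    (hρ : ∀ e : ℝ × ℝ, e.1 ^ 2 + e.2 ^ 2 = 1 → UniformAlong ρ (w e.1 e.2) e)
    {k : ℕ} {len : (Fin (k + 3) → ℝ) → ℝ → ℝ}
    (hlen : Expressible fun env : Vars (k + 3) 9 → ℝ =>
      len (fun i => env (.inl i)) (env (.inr (.inr 0)))) :
    ∃ (P : Program) (C : ℕ), ∀ (n : ℕ) (p : Fin n → ℝ × ℝ) (par : Fin (k + 3) → ℝ), 1 ≤ n →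
      1 < par 0 → par 1 ^ 2 + par 2 ^ 2 = 1 → (∀ R, 0 ≤ R → 0 < len par R) →
      Computes P n (List.ofFn par ++ coords p) (C * n) (C * n) fun mem =>
        ∃ R, 0 ≤ R ∧ (∀ i, |(p i).1| + |(p i).2| ≤ R) ∧
          SolvesLength ρ (par 0) (par 1, par 2) (len par R) p
            (pointAt mem 0) (pointAt mem 2) (pointAt mem 4) := by
  let ν := Vars (k + 3) 9
  have hv : Expressible fun env : ν → ℝ => env (.inl 0) := .var (ν := ν) (.inl 0)
  have h₁ : Expressible fun env : ν → ℝ => env (.inl 1) := .var (ν := ν) (.inl 1)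
  have h₂ : Expressible fun env : ν → ℝ => env (.inl 2) := .var (ν := ν) (.inl 2)
  have hx : Expressible fun env : ν → ℝ => env (.inr (.inl 0)) := .var (ν := ν) (.inr (.inl 0))
  have hy : Expressible fun env : ν → ℝ => env (.inr (.inl 1)) := .var (ν := ν) (.inr (.inl 1))
  have hM (j : Fin 9) : Expressible fun env : ν → ℝ => env (.inr (.inr j)) :=
    .var (ν := ν) (.inr (.inr j))
  have hc : Expressible fun env : ν → ℝ => major (env (.inl 1), env (.inl 2)) := h₁.abs.max h₂.abs
  have hs : Expressible fun env : ν → ℝ => minor (env (.inl 1), env (.inl 2)) := h₁.abs.min h₂.abs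
  have hκ : Expressible fun env : ν → ℝ => w (env (.inl 1)) (env (.inl 2)) / env (.inl 0) :=
    (hw h₁ h₂).div hv
  obtain ⟨X, Y, b, r, ⟨hX, hY, hb⟩, hsol⟩ :=
    exists_expressible_octagon hc hs hκ hlen (fun j : Fin 8 => hM j.succ)
  obtain ⟨hf₁, hf₂⟩ := expressible_unturn h₁ h₂ hX hY
  obtain ⟨P, C, hP⟩ := exists_program_of_expressible (k := k + 3) (m := 9)
    -- Maximum `0` is the largest L₁ norm, used only to choose the length; the other eight are the
    -- support values of the turned clients.
    (Fin.cons (fun _ x y => |x| + |y|) fun j par x y =>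
      dot (normal (major (par 1, par 2)) (minor (par 1, par 2)) (w (par 1) (par 2) / par 0) j)
        (turn (par 1, par 2) (x, y)))
    (![fun env => (unturn (env (.inl 1), env (.inl 2)) (X env, Y env)).1,
      fun env => (unturn (env (.inl 1), env (.inl 2)) (X env, Y env)).2,
      fun env => (unturn (env (.inl 1), env (.inl 2)) (X env, Y env)).1 +
        (b env - len (fun i => env (.inl i)) (env (.inr (.inr 0)))) * env (.inl 1),
      fun env => (unturn (env (.inl 1), env (.inl 2)) (X env, Y env)).2 +
        (b env - len (fun i => env (.inl i)) (env (.inr (.inr 0)))) * env (.inl 2),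
      fun env => (unturn (env (.inl 1), env (.inl 2)) (X env, Y env)).1 + b env * env (.inl 1),
      fun env => (unturn (env (.inl 1), env (.inl 2)) (X env, Y env)).2 + b env * env (.inl 2)])
    (by
      intro j
      refine Fin.cases ?_ (fun j => ?_) j
      · exact hx.abs.add hy.abs
      · obtain ⟨n₁, n₂⟩ := expressible_normal hc hs hκ j
        obtain ⟨t₁, t₂⟩ := expressible_turn h₁ h₂ hx hy
        exact (n₁.mul t₁).add (n₂.mul t₂))
    (by
      intro o
      fin_cases o
      · exact hf₁
      · exact hf₂
      · exact hf₁.add ((hb.sub hlen).mul h₁)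
      · exact hf₂.add ((hb.sub hlen).mul h₂)
      · exact hf₁.add (hb.mul h₁)
      · exact hf₂.add (hb.mul h₂))
  refine ⟨P, C, fun n p par hn hv1 he hpos => ?_⟩
  obtain ⟨T, hT, c, hrun, hhalt, env, hpar, hmax, hout⟩ := hP n p par hn
  have hR0 : 0 ≤ env (.inr (.inr 0)) := by
    have := (hmax 0 _).1 le_rfl ⟨0, hn⟩
    rw [Fin.cons_zero] at this
    exact le_trans (by positivity) this
  refine ⟨T, hT, c, hrun, hhalt, env (.inr (.inr 0)), hR0, ?_, ?_⟩
  · intro i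
    have := (hmax 0 _).1 le_rfl i
    rwa [Fin.cons_zero] at this
  · set R := env (.inr (.inr 0)) with hR
    set e : ℝ × ℝ := (par 1, par 2) with hedef
    have hu := hρ e he
    set L := len par R with hL
    have hL0 : 0 < L := hpos R hR0
    have hoct (F : ℝ × ℝ) (b' r' : ℝ) := le_dot_add_iff_inOctagon (n := n) (p := p)
      (c := major e) (s := minor e) (κ := w (par 1) (par 2) / par 0) (L := L) (b := b') (r := r')
      (e := e) (F := F) (M := fun j : Fin 8 => env (.inr (.inr j.succ)))
      (fun j z => by
        have := hmax j.succ z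
        rwa [Fin.cons_succ] at this)
    have hsol' := hsol env
    simp only [hpar, ← hR, ← hL, ← hedef, hoct] at hsol'
    -- The term for the solution is only meaningful if the program is feasible; any facility and
    -- freeway provide a feasible point.
    have hfeas : ∃ F b' r', 0 ≤ b' ∧ b' ≤ L ∧ 0 ≤ r' ∧
        ∀ i, InOctagon (major e) (minor e) (w (par 1) (par 2) / par 0) L b' r'
          (turn e (p i) - F) := by
      obtain ⟨b', hb', hbL', h⟩ := exists_inOctagon hu hv1 0 (u := 0) (u' := L • e) (r₀ := L)
        (sub_zero _)
      rw [abs_of_pos hL0] at hbL' h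
      exact ⟨turn e 0, b', maxTravelTime ρ (par 0) p 0 0 (L • e), hb', hbL',
        maxTravelTime_nonneg hu hv1 hn p 0 (sub_zero (L • e)), fun i => by
          rw [← turn_sub]
          exact h _ _ ((maxTravelTime_le_iff hn).1 le_rfl i)⟩
    obtain ⟨F₀, b₀, r₀, hb₀, hbL₀, hr₀, h₀⟩ := hfeas
    obtain ⟨hb1, hb2, -, hb3⟩ := hsol' F₀ b₀ r₀ hb₀ hbL₀ hr₀ h₀
    have hfinal := solvesLength_of_octagon hu hv1 hn (p := p) (b := b env) (r := r env) hL0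
      (f := unturn e (X env, Y env)) ⟨hb1, hb2, by rw [turn_unturn]; exact hb3⟩
      (fun F b' r' h1 h2 h3 h4 => (hsol' F b' r' h1 h2 h3 h4).2.2.1)
    have o0 := hout 0
    have o1 := hout 1
    have o2 := hout 2
    have o3 := hout 3
    have o4 := hout 4
    have o5 := hout 5
    simp only [Matrix.cons_val, hpar, ← hR, ← hL, ← hedef] at o0 o1 o2 o3 o4 o5
    convert hfinal using 1
    · exact Prod.ext o0 o1
    · exact Prod.ext o2 o3
    · exact Prod.ext o4 o5

/-! ### From a given parameter length to the fixed and variable length variants. -/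

theorem hasOrientation_iff {α : ℝ} {u u' : ℝ × ℝ} :
    HasOrientation α u u' ↔ ∃ r : ℝ, 0 < |r| ∧ u' - u = r • (Real.cos α, Real.sin α) := by
  simp only [HasOrientation, abs_pos]

theorem solvesFixedLength_iff {v α ℓ : ℝ} (hℓ : 0 < ℓ) {n : ℕ} {p : Fin n → ℝ × ℝ}
    {f t t' : ℝ × ℝ} : SolvesFixedLength ρ v α ℓ p f t t' ↔
      SolvesLength ρ v (Real.cos α, Real.sin α) ℓ p f t t' := by
  have key (u u' : ℝ × ℝ) : (HasOrientation α u u' ∧ l2Dist u u' = ℓ) ↔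
      ∃ r : ℝ, |r| = ℓ ∧ u' - u = r • (Real.cos α, Real.sin α) := by
    have hdist (r : ℝ) (h : u' - u = r • (Real.cos α, Real.sin α)) : l2Dist u u' = |r| := by
      obtain ⟨h1, h2⟩ := Prod.ext_iff.1 h
      simp only [Prod.fst_sub, Prod.snd_sub, Prod.smul_fst, Prod.smul_snd, smul_eq_mul] at h1 h2
      rw [l2Dist, ← Real.sqrt_sq_eq_abs]
      congr 1
      rw [← neg_sub u'.1, ← neg_sub u'.2, h1, h2]
      linear_combination r ^ 2 * Real.cos_sq_add_sin_sq α
    rw [hasOrientation_iff]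
    constructor
    · rintro ⟨⟨r, -, h⟩, hl⟩
      exact ⟨r, by rw [← hdist r h, hl], h⟩
    · rintro ⟨r, hr, h⟩
      exact ⟨⟨r, by rw [hr]; exact hℓ, h⟩, by rw [hdist r h, hr]⟩
  simp only [SolvesFixedLength, SolvesLength, key]

/-- If the freeway is long enough, then an even longer one does not help. -/
theorem SolvesLength.solvesVariableLength {w v α R : ℝ}
    (hρ : UniformAlong ρ w (Real.cos α, Real.sin α)) (hv : 1 < v) (hR : 0 ≤ R) {n : ℕ}
    (hn : 1 ≤ n) {p : Fin n → ℝ × ℝ} (hp : ∀ i, |(p i).1| + |(p i).2| ≤ R) {f t t' : ℝ × ℝ}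
    (h : SolvesLength ρ v (Real.cos α, Real.sin α) (2 * (R + 1) / (w / v)) p f t t') :
    SolvesVariableLength ρ v α p f t t' := by
  set e : ℝ × ℝ := (Real.cos α, Real.sin α)
  set κ := w / v
  have hκ : 0 < κ := hρ.div_pos hv
  -- In time at most `R` one rides at most `R / κ`; the extra `1` keeps the length positive when `R
  -- = 0`.
  set a := (R + 1) / κ with ha
  have ha0 : 0 < a := by positivity
  have h2a : 2 * (R + 1) / κ = 2 * a := mul_div_assoc _ _ _
  rw [h2a] at h
  have hlen : |a - -a| = 2 * a := by rw [abs_of_pos (by linarith)]; ring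
  have hbest (g : ℝ × ℝ) : maxTravelTime ρ v p f t t' ≤
      maxTravelTime ρ v p g (g + (-a) • e) (g + a • e) :=
    h.2 g _ _ ⟨a - -a, hlen, by rw [sub_smul]; abel⟩
  refine ⟨?_, ?_⟩
  · obtain ⟨r, hr, h'⟩ := h.1
    exact hasOrientation_iff.2 ⟨r, by rw [hr]; positivity, h'⟩
  · intro g u u' hu
    obtain ⟨r₀, hr₀, hu⟩ := hasOrientation_iff.1 hu
    -- A competitor taking time at least `R` is matched by walking to the origin. A faster one is
    -- first replaced by a freeway through its facility `g`, whose used part then lies within `a` of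
    -- `g` on either side.
    rcases le_total R (maxTravelTime ρ v p g u u') with hle | hle
    · refine (hbest 0).trans (le_trans ((maxTravelTime_le_iff hn).2 fun i => ?_) hle)
      refine (travelTime_le_l1Dist _ _ _ _).trans ?_
      simpa [l1Dist] using hp i
    · refine (hbest g).trans ((maxTravelTime_le_iff hn).2 fun i => ?_)
      obtain ⟨b, hb, hbL, hoct⟩ := exists_inOctagon hρ hv g hu
      obtain ⟨l, -, -, hl⟩ := (hoct (p i) _ ((maxTravelTime_le_iff hn).1 le_rfl i)).exists_entry
        (minor_nonneg e) hρ.major_pos hb hbL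
      have hla : |l| ≤ a := by
        rw [ha, le_div_iff₀ hκ]
        have h1 := abs_nonneg ((turn e (p i - g)).1 - l * major e)
        have h2 := abs_nonneg ((turn e (p i - g)).2 - l * minor e)
        linarith
      refine travelTime_le_of_entry hρ hv (by linarith) (by linarith) ha0.le (abs_le.1 hla).1
        (abs_le.1 hla).2 ?_
      rwa [l1Dist_add_smul]

/-- Both variants are solved in linear time if distances along the freeway are measured by a
multiple of the Euclidean distance that is given by a term in the direction. -/
theorem exists_programs (w : ℝ → ℝ → ℝ)
    (hw : ∀ {ν : Type} {f g : (ν → ℝ) → ℝ}, Expressible f → Expressible g →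
      Expressible fun env => w (f env) (g env))
    (hρ : ∀ e : ℝ × ℝ, e.1 ^ 2 + e.2 ^ 2 = 1 → UniformAlong ρ (w e.1 e.2) e) :
    (∃ (P : Program) (C : ℕ), ∀ (n : ℕ) (p : Fin n → ℝ × ℝ) (v α ℓ : ℝ),
      1 ≤ n → 1 < v → 0 < ℓ →
        Computes P n ([v, Real.cos α, Real.sin α, ℓ] ++ coords p) (C * n) (C * n)
          (fun mem => SolvesFixedLength ρ v α ℓ p
            (pointAt mem 0) (pointAt mem 2) (pointAt mem 4))) ∧
    (∃ (P : Program) (C : ℕ), ∀ (n : ℕ) (p : Fin n → ℝ × ℝ) (v α : ℝ),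
      1 ≤ n → 1 < v →
        Computes P n ([v, Real.cos α, Real.sin α] ++ coords p) (C * n) (C * n)
          (fun mem => SolvesVariableLength ρ v α p
            (pointAt mem 0) (pointAt mem 2) (pointAt mem 4))) := by
  constructor
  · obtain ⟨P, C, hP⟩ := exists_program w hw hρ (k := 1) (len := fun par _ => par 3)
      (.var (ν := Vars 4 9) (.inl 3))
    refine ⟨P, C, fun n p v α ℓ hn hv hℓ => ?_⟩
    obtain ⟨T, hT, c, hrun, hhalt, R, -, -, h⟩ :=
      hP n p ![v, Real.cos α, Real.sin α, ℓ] hn hv (Real.cos_sq_add_sin_sq α) fun _ _ => hℓ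
    exact ⟨T, hT, c, by simpa using hrun, hhalt, (solvesFixedLength_iff hℓ).2 h⟩
  · have h₀ := Expressible.var (ν := Vars 3 9) (.inl 0)
    have h₁ := Expressible.var (ν := Vars 3 9) (.inl 1)
    have h₂ := Expressible.var (ν := Vars 3 9) (.inl 2)
    have hR := Expressible.var (ν := Vars 3 9) (.inr (.inr 0))
    have htwo : Expressible fun _ : Vars 3 9 → ℝ => (2 : ℝ) := by
      simpa using Expressible.const (ν := Vars 3 9) 2
    obtain ⟨P, C, hP⟩ := exists_program w hw hρ (k := 0)
      (len := fun par R => 2 * (R + 1) / (w (par 1) (par 2) / par 0))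
      ((htwo.mul (hR.add .one)).div ((hw h₁ h₂).div h₀))
    refine ⟨P, C, fun n p v α hn hv => ?_⟩
    have hu := hρ (Real.cos α, Real.sin α) (Real.cos_sq_add_sin_sq α)
    obtain ⟨T, hT, c, hrun, hhalt, R, hR, hp, h⟩ :=
      hP n p ![v, Real.cos α, Real.sin α] hn hv (Real.cos_sq_add_sin_sq α) fun R hR => by
        have := hu.div_pos hv
        exact div_pos (by positivity) this
    exact ⟨T, hT, c, by simpa using hrun, hhalt, h.solvesVariableLength hu hv hR hn hp⟩

end Algorithm

end FreewayLocation

theorem mainTheorem5 (ρ : ℝ × ℝ → ℝ × ℝ → ℝ)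
    (hρ : ρ = FreewayLocation.l1Dist ∨ ρ = FreewayLocation.l2Dist) :
    (∃ (P : RealRAM.Program) (C : ℕ), ∀ (n : ℕ) (p : Fin n → ℝ × ℝ) (v α ℓ : ℝ),
      1 ≤ n → 1 < v → 0 < ℓ →
        RealRAM.Computes P n
          ([v, Real.cos α, Real.sin α, ℓ] ++ FreewayLocation.coords p) (C * n) (C * n)
          (fun mem => FreewayLocation.SolvesFixedLength ρ v α ℓ p
            (FreewayLocation.pointAt mem 0) (FreewayLocation.pointAt mem 2)
            (FreewayLocation.pointAt mem 4))) ∧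
    (∃ (P : RealRAM.Program) (C : ℕ), ∀ (n : ℕ) (p : Fin n → ℝ × ℝ) (v α : ℝ),
      1 ≤ n → 1 < v →
        RealRAM.Computes P n
          ([v, Real.cos α, Real.sin α] ++ FreewayLocation.coords p) (C * n) (C * n)
          (fun mem => FreewayLocation.SolvesVariableLength ρ v α p
            (FreewayLocation.pointAt mem 0) (FreewayLocation.pointAt mem 2)
            (FreewayLocation.pointAt mem 4))) := by
  rcases hρ with rfl | rfl
  · exact FreewayLocation.exists_programs (fun x y => |x| + |y|)
      (fun hf hg => hf.abs.add hg.abs) fun _ => FreewayLocation.uniformAlong_l1Dist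
  · exact FreewayLocation.exists_programs (fun _ _ => 1) (fun _ _ => .one)
      fun _ => FreewayLocation.uniformAlong_l2Dist
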